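/- Let $\Sigma$ be a smooth surface, let $\vec\Phi:\Sigma\to\mathbb{R}^m$ be a smooth immersion with induced metric $g$, second fundamental form $\vec h_{ij}=\nabla_i\nabla_j\vec\Phi$ and mean curvature vector $\vec H=\frac12 g^{ij}\vec h_{ij}$, and suppose that $\Delta_g\vec H=\vec 0$ (Chen's biharmonic equation), where $\Delta_g=\nabla_j\nabla^j$. Work in any smooth local coordinates, with image an open set $\Omega\subset\mathbb{R}^2$. Let $\pi_{\vec n}$ be the projection onto the normal space, $\Delta_\perp\vec H=\pi_{\vec n}\nabla_j\pi_{\vec n}\nabla^j\vec H$, let $\epsilon^{12}=1=-\epsilon^{21}$, $\epsilon^{11}=\epsilon^{22}=0$, $|g|=\det(g_{ij})$, $\star\vec n=\frac12|g|^{-1/2}\epsilon^{ab}\partial_a\vec\Phi\wedge\partial_b\vec\Phi$, and $$\vec{\mathcal W}=\Delta_\perp\vec H+(\vec H\cdot\vec h^i_j)\vec h^j_i-2|\vec H|^2\vec H,\qquad \vec T^j=\nabla^j\vec H-2\pi_{\vec n}\nabla^j\vec H+|\vec H|^2\nabla^j\vec\Phi .$$ For a 2-vector $\alpha$, the contraction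 $\alpha\bullet v$ with a vector $v$ is the vector with $(\alpha\bullet v)\cdot w=\alpha\cdot(v\wedge w)$ for all $w$, and the contraction with a 2-vector is the linear extension of $\alpha\bullet(\beta\wedge\gamma)=(\alpha\bullet\beta)\wedge\gamma-(\alpha\bullet\gamma)\wedge\beta$. Then the following holds. 1. On $\Omega$, $\ \vec{\mathcal W}=2(\vec H\cdot\vec h^{jk})\vec h_{jk}-2|\vec H|^2\vec H$. 2. Put $\vec F^j=|\vec H|^2\nabla^j\vec\Phi-2(\vec H\cdot\vec h^{jk})\nabla_k\vec\Phi$, $\ \vec X=\vec 0$ and $Y=\vec\Phi\cdot\vec H$. On $\Omega$, $$\nabla_j\vec F^j=-\vec{\mathcal W},\qquad \Delta_g\vec X=\vec F^j\wedge\nabla_j\vec\Phi,\qquad \Delta_gY=\vec F^j\cdot\nabla_j\vec\Phi=-2|\vec H|^2 .$$ 3. Let $U\subset\Omega$ be open. If $U$ is simply connected, there is a smooth $\vec L:U\to\mathbb{R}^m$ with $$\vec T^j=\vec F^j+|g|^{-1/2}\epsilon^{kj}\nabla_k\vec L ,$$ and for every such $\vec L$ there are smooth $S:U\to\mathbb{R}$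 and $\vec R:U\to\Lambda^2(\mathbb{R}^m)$ with $$|g|^{-1/2}\epsilon^{kj}\vec L\cdot\nabla_k\vec\Phi=\nabla^jY+|g|^{-1/2}\epsilon^{kj}\nabla_kS,\qquad |g|^{-1/2}\epsilon^{kj}\vec L\wedge\nabla_k\vec\Phi-\vec H\wedge\nabla^j\vec\Phi=\nabla^j\vec X+|g|^{-1/2}\epsilon^{kj}\nabla_k\vec R .$$ For every open $U\subset\Omega$ (simply connected or not) and all smooth $\vec L,S,\vec R$ on $U$ with these properties, $S$, $\vec R$ and $\vec\Phi$ satisfy on $U$ the system $$\left\{\begin{array}{rcl} |g|^{1/2}\Delta_gS&=&\epsilon^{jk}\partial_j(\star\vec n)\cdot\partial_k\vec R\\[1ex] |g|^{1/2}\Delta_g\vec R&=&-\epsilon^{jk}\big[\partial_j(\star\vec n)\,\partial_kS+\partial_j(\star\vec n)\bullet\partial_k\vec R\big]+|g|^{1/2}\nabla_j\big((\star\vec n)\nabla^j(\vec\Phi\cdot\vec H)\big)\\[1ex] |g|^{1/2}\Delta_g\vec\Phi&=&\epsilon^{jk}\big[\partial_jS\,\partial_k\vec\Phi+\partial_j\vec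 R\bullet\partial_k\vec\Phi\big]+|g|^{1/2}\nabla^j(\vec\Phi\cdot\vec H)\,\nabla_j\vec\Phi . \end{array}\right.$$ -/

import Mathlib

open scoped ContDiff Manifold

noncomputable section

namespace Surface

/-- The coordinate plane `ℝ²`. -/
abbrev Plane : Type := EuclideanSpace ℝ (Fin 2)

/-- The ambient Euclidean space `ℝᵐ`. -/
abbrev Amb (m : ℕ) : Type := EuclideanSpace ℝ (Fin m)

/-- The space `Λ²(ℝᵐ)` of 2-vectors, with the inner product
`(a ∧ b) · (c ∧ d) = (a · c)(b · d) - (a · d)(b · c)`. -/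
abbrev TwoVec (m : ℕ) : Type := ⋀[ℝ]^2 (Amb m)

/-! ### Multivectors -/

/-- The 2-vector `a ∧ b`. -/
def wedge {m : ℕ} (a b : Amb m) : TwoVec m := exteriorPower.ιMulti ℝ 2 ![a, b]

/-- Interior multiplication of a 2-vector by a vector: the vector `α ⌞ v` with
`(α ⌞ v) · w = α · (v ∧ w)` for every vector `w` (see `inner_interiorMul`).
It is also the contraction `α • v` of a 2-vector with a vector. -/
def interiorMul {m : ℕ} (α : TwoVec m) (v : Amb m) : Amb m :=
  ∑ i, inner ℝ α (wedge v (EuclideanSpace.single i 1)) • EuclideanSpace.single i (1 : ℝ)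

theorem wedge_add_left {m : ℕ} (a a' b : Amb m) :
    wedge (a + a') b = wedge a b + wedge a' b := by
  have h (c : Amb m) : Function.update ![(0 : Amb m), b] 0 c = ![c, b] := by
    ext i; fin_cases i <;> rfl
  have := (exteriorPower.ιMulti ℝ 2 (M := Amb m)).map_update_add ![0, b] 0 a a'
  rwa [h, h, h] at this

theorem wedge_smul_left {m : ℕ} (c : ℝ) (a b : Amb m) :
    wedge (c • a) b = c • wedge a b := by
  have h (c : Amb m) : Function.update ![(0 : Amb m), b] 0 c = ![c, b] := by
    ext i; fin_cases i <;> rfl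
  have := (exteriorPower.ιMulti ℝ 2 (M := Amb m)).map_update_smul ![0, b] 0 c a
  rwa [h, h] at this

theorem wedge_add_right {m : ℕ} (a b b' : Amb m) :
    wedge a (b + b') = wedge a b + wedge a b' := by
  have h (c : Amb m) : Function.update ![a, (0 : Amb m)] 1 c = ![a, c] := by
    ext i; fin_cases i <;> rfl
  have := (exteriorPower.ιMulti ℝ 2 (M := Amb m)).map_update_add ![a, 0] 1 b b'
  rwa [h, h, h] at this

theorem wedge_smul_right {m : ℕ} (c : ℝ) (a b : Amb m) :
    wedge a (c • b) = c • wedge a b := by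
  have h (c : Amb m) : Function.update ![a, (0 : Amb m)] 1 c = ![a, c] := by
    ext i; fin_cases i <;> rfl
  have := (exteriorPower.ιMulti ℝ 2 (M := Amb m)).map_update_smul ![a, 0] 1 c b
  rwa [h, h] at this

theorem inner_twoVec_smul {m : ℕ} (c : ℝ) (α β : TwoVec m) :
    inner ℝ α (c • β) = c * inner ℝ α β :=
  inner_smul_right α β c

theorem interiorMul_add {m : ℕ} (α : TwoVec m) (v w : Amb m) :
    interiorMul α (v + w) = interiorMul α v + interiorMul α w := by
  simp [interiorMul, wedge_add_left, inner_add_right, add_smul, Finset.sum_add_distrib]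

theorem interiorMul_smul {m : ℕ} (α : TwoVec m) (c : ℝ) (v : Amb m) :
    interiorMul α (c • v) = c • interiorMul α v := by
  simp [interiorMul, wedge_smul_left, inner_twoVec_smul, mul_smul, Finset.smul_sum]

/-- The defining property of interior multiplication. -/
theorem inner_interiorMul {m : ℕ} (α : TwoVec m) (v w : Amb m) :
    inner ℝ (interiorMul α v) w = inner ℝ α (wedge v w) := by
  let f : Amb m →ₗ[ℝ] ℝ :=
    { toFun := fun w => inner ℝ α (wedge v w)
      map_add' := fun a b => by simp [wedge_add_right, inner_add_right]
      map_smul' := fun c a => by simp [wedge_smul_right, inner_twoVec_smul] }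
  let g : Amb m →ₗ[ℝ] ℝ := (innerₗ (Amb m)) (interiorMul α v)
  have hfg : g = f := by
    refine (EuclideanSpace.basisFun (Fin m) ℝ).toBasis.ext fun i => ?_
    simp [f, g, interiorMul, EuclideanSpace.inner_single_left]
  exact LinearMap.congr_fun hfg w

/-- For a 2-vector `α`, the alternating map `(β, γ) ↦ (α • β) ∧ γ - (α • γ) ∧ β`. -/
def contractAlt {m : ℕ} (α : TwoVec m) : (Amb m) [⋀^Fin 2]→ₗ[ℝ] (TwoVec m) where
  toFun v := wedge (interiorMul α (v 0)) (v 1) - wedge (interiorMul α (v 1)) (v 0)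
  map_update_add' := by
    intro inst v i x y
    obtain rfl : inst = instDecidableEqFin 2 := Subsingleton.elim _ _
    fin_cases i <;> simp [wedge_add_left, wedge_add_right, interiorMul_add] <;> abel
  map_update_smul' := by
    intro inst v i c x
    obtain rfl : inst = instDecidableEqFin 2 := Subsingleton.elim _ _
    fin_cases i <;>
      simp [wedge_smul_left, wedge_smul_right, interiorMul_smul, smul_sub]
  map_eq_zero_of_eq' := by
    intro v i j hij hne
    fin_cases i <;> fin_cases j <;> simp_all

/-- The first-order contraction `α • η` of two 2-vectors, i.e. the map which is linear in `η` and
satisfies `α • (β ∧ γ) = (α • β) ∧ γ - (α • γ) ∧ β` for vectors `β`, `γ`. -/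
def contract {m : ℕ} (α η : TwoVec m) : TwoVec m :=
  exteriorPower.alternatingMapLinearEquiv (contractAlt α) η

theorem contract_wedge {m : ℕ} (α : TwoVec m) (b c : Amb m) :
    contract α (wedge b c) = wedge (interiorMul α b) c - wedge (interiorMul α c) b := by
  simp [contract, wedge, contractAlt]

/-! ### Calculus in local coordinates

Here `φ : ℝ² → ℝᵐ` is a local parametrization of the surface. -/

section Calculus

variable {V : Type*} [NormedAddCommGroup V] [NormedSpace ℝ V] {m : ℕ}

/-- The flat partial derivative `∂ᵢ f`. -/
def pd (i : Fin 2) (f : Plane → V) (x : Plane) : V :=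
  fderiv ℝ f x (EuclideanSpace.single i 1)

/-- The Levi-Civita symbol, `ε¹² = 1 = -ε²¹`. -/
def eps : Matrix (Fin 2) (Fin 2) ℝ := !![0, 1; -1, 0]

/-- The induced metric `g_{ij}`. -/
def metric (φ : Plane → Amb m) (x : Plane) : Matrix (Fin 2) (Fin 2) ℝ :=
  Matrix.of fun i j => inner ℝ (pd i φ x) (pd j φ x)

/-- The inverse metric `g^{ij}`. -/
def invMetric (φ : Plane → Amb m) (x : Plane) : Matrix (Fin 2) (Fin 2) ℝ := (metric φ x)⁻¹

/-- `|g|^{1/2}`. -/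
def sqrtG (φ : Plane → Amb m) (x : Plane) : ℝ := √(metric φ x).det

/-- `∇ʲ f = g^{jk} ∂ₖ f`. -/
def grad (φ : Plane → Amb m) (f : Plane → V) (j : Fin 2) (x : Plane) : V :=
  ∑ k, invMetric φ x j k • pd k f x

/-- The covariant divergence `∇ⱼ Fʲ = |g|^{-1/2} ∂ⱼ(|g|^{1/2} Fʲ)`. -/
def divg (φ : Plane → Amb m) (F : Fin 2 → Plane → V) (x : Plane) : V :=
  (sqrtG φ x)⁻¹ • ∑ j, pd j (fun y => sqrtG φ y • F j y) x

/-- The Laplace-Beltrami operator `Δ_g f = ∇ⱼ ∇ʲ f`. -/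
def lap (φ : Plane → Amb m) (f : Plane → V) (x : Plane) : V := divg φ (grad φ f) x

/-- The Christoffel symbols `Γᵏᵢⱼ` of the induced metric. -/
def christoffel (φ : Plane → Amb m) (k i j : Fin 2) (x : Plane) : ℝ :=
  (1 / 2) * ∑ l, invMetric φ x k l *
    (pd i (fun y => metric φ y j l) x + pd j (fun y => metric φ y i l) x
      - pd l (fun y => metric φ y i j) x)

/-- The second fundamental form `h_{ij} = ∇ᵢ∇ⱼ φ`. -/
def sff (φ : Plane → Amb m) (i j : Fin 2) (x : Plane) : Amb m :=
  pd i (pd j φ) x - ∑ k, christoffel φ k i j x • pd k φ x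

/-- `hⁱⱼ`. -/
def sffMixed (φ : Plane → Amb m) (i j : Fin 2) (x : Plane) : Amb m :=
  ∑ a, invMetric φ x i a • sff φ a j x

/-- `h^{ij}`. -/
def sffUp (φ : Plane → Amb m) (i j : Fin 2) (x : Plane) : Amb m :=
  ∑ a, ∑ b, (invMetric φ x i a * invMetric φ x j b) • sff φ a b x

/-- The mean curvature vector `H = ½ g^{ij} h_{ij}`. -/
def meanCurv (φ : Plane → Amb m) (x : Plane) : Amb m :=
  (1 / 2 : ℝ) • ∑ i, ∑ j, invMetric φ x i j • sff φ i j x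

/-- The projection `π_n` onto the normal space at the point with coordinates `x`. -/
def projN (φ : Plane → Amb m) (x : Plane) (v : Amb m) : Amb m :=
  (LinearMap.range (fderiv ℝ φ x).toLinearMap)ᗮ.starProjection v

/-- The Laplacian in the normal bundle, `Δ_⊥ ν = π_n ∇ⱼ π_n ∇ʲ ν`. -/
def lapPerp (φ : Plane → Amb m) (ν : Plane → Amb m) (x : Plane) : Amb m :=
  projN φ x (divg φ (fun j y => projN φ y (grad φ ν j y)) x)

/-- The Willmore operator `W = Δ_⊥ H + (H · hⁱⱼ) hʲᵢ - 2 |H|² H`. -/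
def willmore (φ : Plane → Amb m) (x : Plane) : Amb m :=
  lapPerp φ (meanCurv φ) x
    + ∑ i, ∑ j, inner ℝ (meanCurv φ x) (sffMixed φ i j x) • sffMixed φ j i x
    - (2 * ‖meanCurv φ x‖ ^ 2) • meanCurv φ x

/-- The stress-energy tensor `Tʲ = ∇ʲH - 2 π_n ∇ʲH + |H|² ∇ʲφ`. -/
def stress (φ : Plane → Amb m) (j : Fin 2) (x : Plane) : Amb m :=
  grad φ (meanCurv φ) j x - (2 : ℝ) • projN φ x (grad φ (meanCurv φ) j x)
    + ‖meanCurv φ x‖ ^ 2 • grad φ φ j x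

/-- The Gauss map, as the 2-vector `⋆n = ½ |g|^{-1/2} ε^{ab} ∂ₐφ ∧ ∂_bφ`. -/
def starN (φ : Plane → Amb m) (x : Plane) : TwoVec m :=
  (1 / 2 * (sqrtG φ x)⁻¹) • ∑ a, ∑ b, eps a b • wedge (pd a φ x) (pd b φ x)

/-- The tangential field `Fʲ = |H|² ∇ʲφ - 2 (H · h^{jk}) ∂ₖφ`. -/
def chenField (φ : Plane → Amb m) (j : Fin 2) (x : Plane) : Amb m :=
  ‖meanCurv φ x‖ ^ 2 • grad φ φ j x
    - (2 : ℝ) • ∑ k, inner ℝ (meanCurv φ x) (sffUp φ j k x) • pd k φ x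

/-- The side equations on `U` for a field `Fʲ` (in the role of `∇ʲV`), a 2-vector `X` and a
function `Y`: `∇ⱼFʲ = -W`, `Δ_g X = Fʲ ∧ ∂ⱼφ`, `Δ_g Y = Fʲ · ∂ⱼφ`. -/
def SideSystem (φ : Plane → Amb m) (F : Fin 2 → Plane → Amb m) (X : Plane → TwoVec m)
    (Y : Plane → ℝ) (U : Set Plane) : Prop :=
  ∀ x ∈ U, divg φ F x = -willmore φ x ∧
    lap φ X x = ∑ j, wedge (F j x) (pd j φ x) ∧
    lap φ Y x = ∑ j, inner ℝ (F j x) (pd j φ x)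

/-- `L` is a smooth potential on `U` in the Hodge decomposition
`Tʲ = Fʲ + |g|^{-1/2} ε^{kj} ∂ₖL`. -/
def IsPotentialL (φ : Plane → Amb m) (F : Fin 2 → Plane → Amb m) (L : Plane → Amb m)
    (U : Set Plane) : Prop :=
  ContDiffOn ℝ ∞ L U ∧ ∀ x ∈ U, ∀ j,
    stress φ j x = F j x + (sqrtG φ x)⁻¹ • ∑ k, eps k j • pd k L x

/-- `S` and `R` are smooth potentials on `U` in the Hodge decompositions
`|g|^{-1/2} ε^{kj} L · ∂ₖφ = ∇ʲY + |g|^{-1/2} ε^{kj} ∂ₖS` and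
`|g|^{-1/2} ε^{kj} L ∧ ∂ₖφ - H ∧ ∇ʲφ = ∇ʲX + |g|^{-1/2} ε^{kj} ∂ₖR`. -/
def IsPotentialSR (φ : Plane → Amb m) (X : Plane → TwoVec m) (Y : Plane → ℝ)
    (L : Plane → Amb m) (S : Plane → ℝ) (R : Plane → TwoVec m) (U : Set Plane) : Prop :=
  ContDiffOn ℝ ∞ S U ∧ ContDiffOn ℝ ∞ R U ∧ ∀ x ∈ U, ∀ j,
    ((sqrtG φ x)⁻¹ * ∑ k, eps k j * inner ℝ (L x) (pd k φ x)
      = grad φ Y j x + (sqrtG φ x)⁻¹ * ∑ k, eps k j * pd k S x) ∧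
    ((sqrtG φ x)⁻¹ • ∑ k, eps k j • wedge (L x) (pd k φ x) - wedge (meanCurv φ x) (grad φ φ j x)
      = grad φ X j x + (sqrtG φ x)⁻¹ • ∑ k, eps k j • pd k R x)

end Calculus

section Manifold

variable {M : Type*} [TopologicalSpace M] [ChartedSpace Plane M] {m : ℕ}

/-- A smooth immersion of the surface `M` into `ℝᵐ`. -/
def IsSmoothImmersion (Φ : M → Amb m) : Prop :=
  ContMDiff 𝓘(ℝ, Plane) 𝓘(ℝ, Amb m) ∞ Φ ∧
    ∀ p, Function.Injective (mfderiv 𝓘(ℝ, Plane) 𝓘(ℝ, Amb m) Φ p)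

/-- Chen's equation `Δ_g H = 0`, expressed in the smooth local coordinates of `M`. -/
def SatisfiesChen (Φ : M → Amb m) : Prop :=
  ∀ e ∈ IsManifold.maximalAtlas 𝓘(ℝ, Plane) ∞ M, ∀ x ∈ e.target,
    lap (Φ ∘ e.symm) (meanCurv (Φ ∘ e.symm)) x = 0

end Manifold

end Surface

end

/-! Write `Aʲ = (H · hʲᵏ) ∂ₖφ` (`shapeField`). By Weingarten's relation `∂ᵢH · ∂ⱼφ = -H · hᵢⱼ`, it
is minus the tangential part of `∇ʲH`, so `π_n ∇ʲH = ∇ʲH + Aʲ` and `Tʲ = Fʲ - ∇ʲH` with `Fʲ = |H|²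
∇ʲφ - 2Aʲ` (`stress_eq`). Chen's equation thus says that `Tʲ - Fʲ` is divergence-free, and `L` is a
conjugate of `-H`.

Since `∇ⱼ∇ʲH = 0`, `Δ_⊥ H` is the normal part of `∇ⱼAʲ`, namely `(H · hʲᵏ) hⱼₖ`. This doubles the
quadratic term of `W`. The normal part of `∇ⱼFʲ = -W` follows at once from `Δφ = 2H` (`lap_self`).
The tangential part is the delicate point: it amounts to `(∇ⱼAʲ) · ∂ₗφ = H · ∂ₗH`
(`inner_divg_shapeField_pd`). In place of an explicit Codazzi equation, the proof differentiates `Δφ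
= 2H` along `∂ₗ`, pairs with `H` and integrates by parts using Chen's equation. The choice `X = 0`
is possible because `Fʲ` has symmetric coefficients in `∂ₖφ`. The choice `Y = φ · H` works because
`H` is normal and `∇ʲH · ∂ⱼφ = -2|H|²`.

The potentials come from the Poincaré lemma, as in the plane divergence-free fields are rotated
gradients (`exists_potential`). The integrability conditions for `S` and `R` reduce to `∇ʲH · ∂ⱼφ =
ΔY` and to the equality of `∇ʲH ∧ ∂ⱼφ` with `∇ⱼ(H ∧ ∇ʲφ)`.

Inverting the decompositions gives the first derivatives of `S` and `R` explicitly, and then `ΔS = 2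
L · H` and `ΔR = 2 L ∧ H` (`lap_potentialS`, `lap_potentialR`). With `∂ⱼ(⋆n)` expressed through the
second fundamental form (`pd_starN`), each equation of the system becomes a pointwise identity of
multilinear algebra: `inner_gaussMap_potential`, `contract_gaussMap_potential`,
`interiorMul_potential`. -/

noncomputable section

/-! ### The Poincaré lemma on simply connected open sets -/

open Set Filter Topology in
/-- On a simply connected space, a locally constant additive Čech 1-cocycle is a coboundary of
locally constant functions. -/
theorem exists_locallyConstant_coboundary {X ι A : Type*} [TopologicalSpace X]
    [SimplyConnectedSpace X] [LocallyPathConnectedSpace X] [AddCommGroup A]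
    (b : ι → Set X) (hb : ∀ i, IsOpen (b i)) (hcov : ∀ x, ∃ i, x ∈ b i)
    (c : ι → ι → X → A)
    (hloc : ∀ i j, ∀ x ∈ b i ∩ b j, ∀ᶠ y in 𝓝 x, c i j y = c i j x)
    (hself : ∀ i, ∀ x ∈ b i, c i i x = 0)
    (hcocycle : ∀ i j k, ∀ x ∈ b i ∩ b j ∩ b k, c i j x + c j k x = c i k x) :
    ∃ s : ι → X → A, (∀ i, ∀ x ∈ b i, ∀ᶠ y in 𝓝 x, s i y = s i x) ∧
      ∀ i j, ∀ x ∈ b i ∩ b j, s j x = s i x + c i j x := by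
  choose idx hidx using hcov
  -- With `A` discrete, translations by the cocycle glue the sets `b i × A` into a covering space of
  -- `X`.
  let _ : TopologicalSpace A := ⊥
  have _ : DiscreteTopology A := ⟨rfl⟩
  let Z : FiberBundleCore ι X A :=
    { baseSet := b
      isOpen_baseSet := hb
      indexAt := idx
      mem_baseSet_at := hidx
      coordChange := fun i j x v => v + c i j x
      coordChange_self := fun i x hx v => by simp [hself i x hx]
      continuousOn_coordChange := by
        rintro i j ⟨x, v⟩ ⟨hx, -⟩
        refine ContinuousAt.continuousWithinAt ?_
        have h1 : ∀ᶠ p : X × A in 𝓝 (x, v), c i j p.1 = c i j x :=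
          (continuous_fst.tendsto (x, v)).eventually (hloc i j x hx)
        have h2 : ∀ᶠ p : X × A in 𝓝 (x, v), p.2 = v :=
          (continuous_snd.tendsto (x, v)).eventually ((isOpen_discrete {v}).mem_nhds rfl)
        refine (continuousAt_const (y := v + c i j x)).congr ?_
        filter_upwards [h1, h2] with p hp1 hp2
        rw [hp1, hp2]
      coordChange_comp := fun i j k x hx v => by
        rw [add_assoc, hcocycle i j k x hx] }
  have cov : IsCoveringMap (Bundle.TotalSpace.proj : Z.TotalSpace → X) :=
    FiberBundle.isCoveringMap
  obtain ⟨x₀⟩ : Nonempty X := inferInstance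
  -- A lift of the identity is a global section. Read in the trivialization over `b i`, it is a
  -- continuous map to a discrete space; these readings are the functions `s i`.
  obtain ⟨F, ⟨-, hF⟩, -⟩ := cov.existsUnique_continuousMap_lifts (ContinuousMap.id X)
    (a₀ := x₀) (e₀ := (⟨x₀, (0 : A)⟩ : Z.TotalSpace)) rfl
  have hF' (x : X) : (F x).proj = x := congrFun hF x
  refine ⟨fun i x => (Z.localTriv i (F x)).2, fun i x hx => ?_, fun i j x hx => ?_⟩
  · have hsrc : F x ∈ (Z.localTriv i).source := by
      rw [Z.mem_localTriv_source]
      change (F x).proj ∈ b i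
      rwa [hF']
    have h1 : ContinuousAt (fun x => (Z.localTriv i (F x)).2) x :=
      continuous_snd.continuousAt.comp
        (((Z.localTriv i).continuousOn.continuousAt
          ((Z.localTriv i).open_source.mem_nhds hsrc)).comp F.continuous.continuousAt)
    have h2 := h1.tendsto
    rw [nhds_discrete A, tendsto_pure] at h2
    exact h2
  · let v : A := (F x).2
    change v + c (idx (F x).proj) j (F x).proj = v + c (idx (F x).proj) i (F x).proj + c i j x
    rw [hF', add_assoc, hcocycle _ _ _ _ ⟨⟨hidx x, hx.1⟩, hx.2⟩]

open Set Filter Topology in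
/-- **Poincaré lemma** for 1-forms on a simply connected open set. -/
theorem exists_hasFDerivAt_of_isSimplyConnected {E V : Type*} [NormedAddCommGroup E]
    [NormedSpace ℝ E] [NormedAddCommGroup V] [NormedSpace ℝ V] [CompleteSpace V]
    {U : Set E} (hU : IsOpen U) (hsc : IsSimplyConnected U) {η : E → E →L[ℝ] V}
    (hη : DifferentiableOn ℝ η U)
    (hclosed : ∀ a ∈ U, ∀ x y, fderiv ℝ η a x y = fderiv ℝ η a y x) :
    ∃ f : E → V, ∀ a ∈ U, HasFDerivAt f (η a) a := by
  classical
  have := hsc.simplyConnectedSpace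
  have := hU.locallyPathConnectedSpace
  have hball (p : U) : ∃ r > 0, Metric.ball (p : E) r ⊆ U := Metric.isOpen_iff.1 hU p p.2
  choose r hr hrU using hball
  have hprim (p : U) : ∃ f : E → V, ∀ a ∈ Metric.ball (p : E) (r p), HasFDerivAt f (η a) a :=
    (convex_ball _ _).exists_forall_hasFDerivAt_of_fderiv_symmetric Metric.isOpen_ball
      (hη.mono (hrU p)) fun a ha => hclosed a (hrU p ha)
  choose f hf using hprim
  have hsub {x : U} {B : Set E} (hB : IsOpen B) (hx : (x : E) ∈ B) {g : E → V}
      (hg : ∀ y ∈ B, HasFDerivAt g (0 : E →L[ℝ] V) y) : ∀ᶠ y in 𝓝 (x : E), g y = g x := by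
    obtain ⟨ε, hε, hεB⟩ := Metric.isOpen_iff.1 hB x hx
    filter_upwards [Metric.ball_mem_nhds (x : E) hε] with y hy
    refine (convex_ball (x : E) ε).is_const_of_fderivWithin_eq_zero (𝕜 := ℝ)
      (fun z hz => (hg z (hεB hz)).differentiableAt.differentiableWithinAt) (fun z hz => ?_)
      hy (Metric.mem_ball_self hε)
    rw [fderivWithin_of_isOpen Metric.isOpen_ball hz, (hg z (hεB hz)).fderiv]
  -- Two local primitives differ by a locally constant function on the overlap of their balls. These
  -- differences form a cocycle, and a coboundary `s` makes the corrected primitives `s p + f p`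
  -- agree.
  obtain ⟨s, hs, hss⟩ := exists_locallyConstant_coboundary (X := U) (ι := U) (A := V)
    (fun p => Subtype.val ⁻¹' Metric.ball (p : E) (r p))
    (fun p => Metric.isOpen_ball.preimage continuous_subtype_val)
    (fun x => ⟨x, Metric.mem_ball_self (hr x)⟩)
    (fun p q x => f p x - f q x)
    (fun p q x hx => by
      have h := hsub (x := x) (Metric.isOpen_ball.inter Metric.isOpen_ball) hx
        (g := fun y => f p y - f q y)
        (fun y hy => by
          have h := (hf p y hy.1).sub (hf q y hy.2)
          rw [sub_self] at h
          exact h)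
      exact continuous_subtype_val.continuousAt.eventually h)
    (fun p x _ => by simp) (fun p q t x _ => by simp)
  -- At `x` the glued primitive is evaluated in the ball centred at `x`. Near `a` it coincides with
  -- the one attached to `a`, by the coboundary relation.
  refine ⟨fun x => if h : x ∈ U then s ⟨x, h⟩ ⟨x, h⟩ + f ⟨x, h⟩ x else 0, fun a ha => ?_⟩
  let p : U := ⟨a, ha⟩
  have hs' : ∀ᶠ y in 𝓝 a, ∀ h : y ∈ U, s p ⟨y, h⟩ = s p p := by
    have := hs p p (Metric.mem_ball_self (hr p))
    rw [nhds_subtype_eq_comap, eventually_comap] at this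
    filter_upwards [this] with y hy h using hy ⟨y, h⟩ rfl
  refine ((hf p a (Metric.mem_ball_self (hr p))).const_add (s p p)).congr_of_eventuallyEq ?_
  filter_upwards [hs', hU.mem_nhds ha, Metric.ball_mem_nhds a (hr p)] with y h1 h2 h3
  rw [dif_pos h2, hss p ⟨y, h2⟩ ⟨y, h2⟩ ⟨h3, Metric.mem_ball_self (hr _)⟩, h1 h2]
  abel

namespace Surface

/-! ### From the surface to local coordinates -/

theorem contDiffOn_comp_chart_symm {m : ℕ} {M : Type*} [TopologicalSpace M]
    [ChartedSpace Plane M] [IsManifold 𝓘(ℝ, Plane) ∞ M] {Φ : M → Amb m}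
    (hΦ : IsSmoothImmersion Φ) {e : OpenPartialHomeomorph M Plane}
    (he : e ∈ IsManifold.maximalAtlas 𝓘(ℝ, Plane) ∞ M) :
    ContDiffOn ℝ ∞ (Φ ∘ e.symm) e.target :=
  contMDiffOn_iff_contDiffOn.1
    (hΦ.1.comp_contMDiffOn (contMDiffOn_symm_of_mem_maximalAtlas he))

theorem fderiv_comp_chart_symm_injective {m : ℕ} {M : Type*} [TopologicalSpace M]
    [ChartedSpace Plane M] [IsManifold 𝓘(ℝ, Plane) ∞ M] {Φ : M → Amb m}
    (hΦ : IsSmoothImmersion Φ) {e : OpenPartialHomeomorph M Plane}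
    (he : e ∈ IsManifold.maximalAtlas 𝓘(ℝ, Plane) ∞ M) {x : Plane} (hx : x ∈ e.target) :
    Function.Injective (fderiv ℝ (Φ ∘ e.symm) x) := by
  have hsm : MDifferentiableAt 𝓘(ℝ, Plane) 𝓘(ℝ, Plane) e.symm x :=
    (contMDiffAt_symm_of_mem_maximalAtlas he hx).mdifferentiableAt (by simp)
  have hem : MDifferentiableAt 𝓘(ℝ, Plane) 𝓘(ℝ, Plane) e (e.symm x) :=
    (contMDiffAt_of_mem_maximalAtlas he (e.map_target hx)).mdifferentiableAt (by simp)
  have hΦm : MDifferentiableAt 𝓘(ℝ, Plane) 𝓘(ℝ, Amb m) Φ (e.symm x) :=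
    hΦ.1.mdifferentiableAt (by simp)
  rw [← mfderiv_eq_fderiv, mfderiv_comp x hΦm hsm]
  have hid : (mfderiv 𝓘(ℝ, Plane) 𝓘(ℝ, Plane) e (e.symm x)).comp
      (mfderiv 𝓘(ℝ, Plane) 𝓘(ℝ, Plane) e.symm x) = ContinuousLinearMap.id ℝ _ := by
    rw [← mfderiv_comp x hem hsm, ← mfderiv_id]
    refine Filter.EventuallyEq.mfderiv_eq ?_
    filter_upwards [e.open_target.mem_nhds hx] with y hy using e.right_inv hy
  have hinj : Function.Injective (mfderiv 𝓘(ℝ, Plane) 𝓘(ℝ, Plane) e.symm x) :=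
    Function.LeftInverse.injective (g := mfderiv 𝓘(ℝ, Plane) 𝓘(ℝ, Plane) e (e.symm x))
      fun v => DFunLike.congr_fun hid v
  exact (hΦ.2 _).comp hinj

/-! ### Algebra of 2-vectors -/

section Multivectors

variable {m : ℕ}

theorem wedge_self (a : Amb m) : wedge a a = 0 :=
  (exteriorPower.ιMulti ℝ 2).map_eq_zero_of_eq ![a, a] (i := 0) (j := 1) rfl (by decide)

theorem wedge_swap (a b : Amb m) : wedge b a = -wedge a b := by
  have h := wedge_self (a + b)
  rw [wedge_add_left, wedge_add_right, wedge_add_right, wedge_self, wedge_self, zero_add,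
    add_zero] at h
  exact eq_neg_of_add_eq_zero_right h

theorem inner_wedge (a b c d : Amb m) :
    inner ℝ (wedge a b) (wedge c d) = inner ℝ a c * inner ℝ b d - inner ℝ a d * inner ℝ b c := by
  rw [wedge, wedge, exteriorPower.inner_ιMulti_ιMulti, Matrix.det_fin_two]
  simp only [Matrix.of_apply, Matrix.cons_val_zero, Matrix.cons_val_one]
  ring

theorem interiorMul_wedge (a b v : Amb m) :
    interiorMul (wedge a b) v = inner ℝ a v • b - inner ℝ b v • a := by
  refine ext_inner_right ℝ fun w => ?_
  rw [inner_interiorMul, inner_wedge, inner_sub_left, real_inner_smul_left, real_inner_smul_left]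
  ring

theorem interiorMul_add_left (α β : TwoVec m) (v : Amb m) :
    interiorMul (α + β) v = interiorMul α v + interiorMul β v :=
  ext_inner_right ℝ fun w => by
    rw [inner_add_left, inner_interiorMul, inner_interiorMul, inner_interiorMul, inner_add_left]

theorem interiorMul_smul_left (c : ℝ) (α : TwoVec m) (v : Amb m) :
    interiorMul (c • α) v = c • interiorMul α v :=
  ext_inner_right ℝ fun w => by
    rw [real_inner_smul_left, inner_interiorMul, inner_interiorMul, real_inner_comm,
      inner_twoVec_smul, real_inner_comm]

/-- The wedge product of two vectors as a continuous bilinear map. -/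
def wedgeL (m : ℕ) : Amb m →L[ℝ] Amb m →L[ℝ] TwoVec m :=
  LinearMap.toContinuousBilinearMap
    (LinearMap.mk₂ ℝ wedge wedge_add_left wedge_smul_left wedge_add_right wedge_smul_right)

theorem wedgeL_apply (a b : Amb m) : wedgeL m a b = wedge a b := rfl

theorem contract_add_right (α η θ : TwoVec m) :
    contract α (η + θ) = contract α η + contract α θ := map_add _ _ _

theorem contract_smul_right (α : TwoVec m) (c : ℝ) (η : TwoVec m) :
    contract α (c • η) = c • contract α η := map_smul _ _ _

end Multivectors

/-! ### Calculus of partial derivatives -/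

section PartialDerivatives

variable {V : Type*} [NormedAddCommGroup V] [NormedSpace ℝ V] {m : ℕ} {U : Set Plane}
  {x : Plane} (i j : Fin 2)

theorem ContDiffOn.pd {f : Plane → V} (hU : IsOpen U) (hf : ContDiffOn ℝ ∞ f U) :
    ContDiffOn ℝ ∞ (pd i f) U :=
  ((contDiffOn_infty_iff_fderiv_of_isOpen hU).1 hf).2.clm_apply contDiffOn_const

theorem differentiableAt_of_contDiffOn {f : Plane → V} (hU : IsOpen U) (hf : ContDiffOn ℝ ∞ f U)
    (hx : x ∈ U) : DifferentiableAt ℝ f x :=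
  (hf.contDiffAt (hU.mem_nhds hx)).differentiableAt (by simp)

theorem pd_congr {f g : Plane → V} (hU : IsOpen U) (h : ∀ y ∈ U, f y = g y) (hx : x ∈ U) :
    pd i f x = pd i g x := by
  have : f =ᶠ[nhds x] g := Filter.eventually_of_mem (hU.mem_nhds hx) h
  rw [pd, pd, this.fderiv_eq]

theorem pd_const (v : V) : pd i (fun _ : Plane => v) x = 0 := by
  simp [pd]

theorem pd_comm {f : Plane → V} (hU : IsOpen U) (hf : ContDiffOn ℝ ∞ f U) (hx : x ∈ U) :
    pd i (pd j f) x = pd j (pd i f) x := by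
  have hfx : ContDiffAt ℝ ∞ f x := hf.contDiffAt (hU.mem_nhds hx)
  have hsymm := hfx.isSymmSndFDerivAt
    (by simpa using WithTop.coe_le_coe.2 (le_top : (2 : ℕ∞) ≤ ⊤))
  have hd : DifferentiableAt ℝ (fderiv ℝ f) x :=
    differentiableAt_of_contDiffOn hU ((contDiffOn_infty_iff_fderiv_of_isOpen hU).1 hf).2 hx
  have h (k l : Fin 2) : pd k (pd l f) x =
      fderiv ℝ (fderiv ℝ f) x (EuclideanSpace.single k 1) (EuclideanSpace.single l 1) := by
    change fderiv ℝ (fun y => fderiv ℝ f y (EuclideanSpace.single l 1)) x _ = _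
    rw [fderiv_clm_apply hd (differentiableAt_const _)]
    simp
  rw [h, h, hsymm.eq]

theorem pd_add {f g : Plane → V} (hf : DifferentiableAt ℝ f x) (hg : DifferentiableAt ℝ g x) :
    pd i (fun y => f y + g y) x = pd i f x + pd i g x := by
  rw [pd, fderiv_fun_add hf hg]; rfl

theorem pd_sub {f g : Plane → V} (hf : DifferentiableAt ℝ f x) (hg : DifferentiableAt ℝ g x) :
    pd i (fun y => f y - g y) x = pd i f x - pd i g x := by
  rw [pd, fderiv_fun_sub hf hg]; rfl

theorem pd_neg {f : Plane → V} : pd i (fun y => -f y) x = -pd i f x := by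
  rw [pd, fderiv_fun_neg]; rfl

theorem pd_smul {c : Plane → ℝ} {f : Plane → V} (hc : DifferentiableAt ℝ c x)
    (hf : DifferentiableAt ℝ f x) :
    pd i (fun y => c y • f y) x = pd i c x • f x + c x • pd i f x := by
  rw [pd, fderiv_fun_smul hc hf]
  simp [pd, add_comm]

theorem pd_mul {c d : Plane → ℝ} (hc : DifferentiableAt ℝ c x) (hd : DifferentiableAt ℝ d x) :
    pd i (fun y => c y * d y) x = pd i c x * d x + c x * pd i d x :=
  pd_smul i hc hd

theorem pd_const_smul (c : ℝ) {f : Plane → V} (hf : DifferentiableAt ℝ f x) :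
    pd i (fun y => c • f y) x = c • pd i f x := by
  rw [pd, fderiv_fun_const_smul hf]; rfl

theorem pd_inner {f g : Plane → Amb m} (hf : DifferentiableAt ℝ f x)
    (hg : DifferentiableAt ℝ g x) :
    pd i (fun y => (inner ℝ (f y) (g y) : ℝ)) x
      = inner ℝ (pd i f x) (g x) + inner ℝ (f x) (pd i g x) := by
  rw [pd, fderiv_inner_apply ℝ hf hg, add_comm]; rfl

theorem pd_wedge {f g : Plane → Amb m} (hf : DifferentiableAt ℝ f x)
    (hg : DifferentiableAt ℝ g x) :
    pd i (fun y => wedge (f y) (g y)) x = wedge (pd i f x) (g x) + wedge (f x) (pd i g x) := by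
  have h := (wedgeL m).hasFDerivAt_of_bilinear hf.hasFDerivAt hg.hasFDerivAt
  simp only [wedgeL_apply] at h
  rw [pd, h.fderiv, _root_.add_apply, ContinuousLinearMap.precompR_apply,
    ContinuousLinearMap.precompL_apply, ContinuousLinearMap.compL_apply,
    ContinuousLinearMap.comp_apply, wedgeL_apply, wedgeL_apply, add_comm]
  rfl

theorem ContDiffOn.wedge {f g : Plane → Amb m} (hf : ContDiffOn ℝ ∞ f U)
    (hg : ContDiffOn ℝ ∞ g U) : ContDiffOn ℝ ∞ (fun y => wedge (f y) (g y)) U :=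
  (wedgeL m).isBoundedBilinearMap.contDiff.comp_contDiffOn (hf.prodMk hg)

end PartialDerivatives

/-- On a simply connected open set of the plane there is a smooth function with prescribed smooth
partial derivatives satisfying the compatibility condition. -/
theorem exists_contDiffOn_pd_eq {V : Type*} [NormedAddCommGroup V] [NormedSpace ℝ V]
    [CompleteSpace V] {U : Set Plane} (hU : IsOpen U) (hsc : IsSimplyConnected U)
    {p q : Plane → V} (hp : ContDiffOn ℝ ∞ p U) (hq : ContDiffOn ℝ ∞ q U)
    (hpq : ∀ x ∈ U, pd 1 p x = pd 0 q x) :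
    ∃ f : Plane → V, ContDiffOn ℝ ∞ f U ∧ ∀ x ∈ U, pd 0 f x = p x ∧ pd 1 f x = q x := by
  let η : Plane → Plane →L[ℝ] V := fun x =>
    (EuclideanSpace.proj (0 : Fin 2) : Plane →L[ℝ] ℝ).smulRight (p x)
      + (EuclideanSpace.proj (1 : Fin 2) : Plane →L[ℝ] ℝ).smulRight (q x)
  have hη : ContDiffOn ℝ ∞ η U :=
    (contDiffOn_const.smulRight hp).add (contDiffOn_const.smulRight hq)
  have hηapply (x v : Plane) : η x v = v 0 • p x + v 1 • q x := rfl
  have hfd (a : Plane) (ha : a ∈ U) (v w : Plane) : fderiv ℝ η a v w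
      = w 0 • fderiv ℝ p a v + w 1 • fderiv ℝ q a v := by
    have h1 : fderiv ℝ (fun y => η y w) a v = fderiv ℝ η a v w := by
      rw [fderiv_clm_apply (differentiableAt_of_contDiffOn hU hη ha) (differentiableAt_const _)]
      simp
    rw [← h1]
    simp only [hηapply]
    have hp' := differentiableAt_of_contDiffOn hU hp ha
    have hq' := differentiableAt_of_contDiffOn hU hq ha
    rw [fderiv_fun_add (hp'.fun_const_smul _) (hq'.fun_const_smul _), fderiv_fun_const_smul hp',
      fderiv_fun_const_smul hq']
    rfl
  have hdec (v : Plane) : v = v 0 • EuclideanSpace.single (0 : Fin 2) (1 : ℝ)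
      + v 1 • EuclideanSpace.single (1 : Fin 2) (1 : ℝ) := by
    ext k; fin_cases k <;> simp
  obtain ⟨f, hf⟩ := exists_hasFDerivAt_of_isSimplyConnected hU hsc
    (hη.differentiableOn (by simp)) (fun a ha v w => by
      have hpd (g : Plane → V) (u : Plane) :
          fderiv ℝ g a u = u 0 • pd 0 g a + u 1 • pd 1 g a := by
        conv_lhs => rw [hdec u]
        simp [pd]
      rw [hfd a ha, hfd a ha, hpd p, hpd q, hpd p, hpd q, hpq a ha]
      module)
  refine ⟨f, (contDiffOn_infty_iff_fderiv_of_isOpen hU).2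
    ⟨fun x hx => (hf x hx).differentiableAt.differentiableWithinAt,
      hη.congr fun x hx => (hf x hx).fderiv⟩, fun x hx => ?_⟩
  rw [pd, pd, (hf x hx).fderiv, hηapply, hηapply]
  simp

/-! ### Algebra of the induced metric -/

/-- `φ` is a smooth immersion of the open set `U ⊆ ℝ²`. -/
structure IsImmersedOn {m : ℕ} (φ : Plane → Amb m) (U : Set Plane) : Prop where
  isOpen : IsOpen U
  contDiffOn : ContDiffOn ℝ ∞ φ U
  det_pos : ∀ x ∈ U, 0 < (metric φ x).det

section

variable {V : Type*} [NormedAddCommGroup V] [NormedSpace ℝ V] {m : ℕ} {φ : Plane → Amb m}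
  {U : Set Plane} {x : Plane}

theorem metric_apply (φ : Plane → Amb m) (x : Plane) (i j : Fin 2) :
    metric φ x i j = inner ℝ (pd i φ x) (pd j φ x) := rfl

theorem metric_comm (φ : Plane → Amb m) (x : Plane) (i j : Fin 2) :
    metric φ x i j = metric φ x j i :=
  real_inner_comm (pd j φ x) (pd i φ x)

theorem det_metric (φ : Plane → Amb m) (x : Plane) :
    (metric φ x).det = metric φ x 0 0 * metric φ x 1 1 - metric φ x 0 1 * metric φ x 0 1 := by
  rw [Matrix.det_fin_two, metric_comm φ x 1 0]

theorem det_metric_pos_of_injective (h : Function.Injective (fderiv ℝ φ x)) :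
    0 < (metric φ x).det := by
  have ha : pd 0 φ x ≠ 0 := fun h0 => by
    have := h (h0.trans (map_zero (fderiv ℝ φ x)).symm)
    simpa using congrArg (fun v : Plane => v 0) this
  have haa : 0 < metric φ x 0 0 := by
    rw [metric_apply, real_inner_self_eq_norm_sq]; positivity
  -- Gram-Schmidt: the image of `v` is `-g₀₀` times the component of `∂₁φ` orthogonal to `∂₀φ`, and
  -- its squared length is `g₀₀ det g`.
  let v : Plane := metric φ x 0 1 • EuclideanSpace.single 0 1
    - metric φ x 0 0 • EuclideanSpace.single 1 1
  have hv : fderiv ℝ φ x v = metric φ x 0 1 • pd 0 φ x - metric φ x 0 0 • pd 1 φ x := by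
    simp [v, pd]
  have hv0 : fderiv ℝ φ x v ≠ 0 := fun h0 => by
    have := h (h0.trans (map_zero (fderiv ℝ φ x)).symm)
    have := congrArg (fun v : Plane => v 1) this
    simp [v] at this
    exact haa.ne' this
  have hn : 0 < inner ℝ (fderiv ℝ φ x v) (fderiv ℝ φ x v) := by
    rw [real_inner_self_eq_norm_sq]; positivity
  have key : inner ℝ (fderiv ℝ φ x v) (fderiv ℝ φ x v)
      = metric φ x 0 0 * (metric φ x).det := by
    rw [hv, det_metric]
    simp only [inner_sub_left, inner_sub_right, real_inner_smul_left, real_inner_smul_right,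
      metric_apply, real_inner_comm (pd 0 φ x) (pd 1 φ x)]
    ring
  rw [key] at hn
  exact pos_of_mul_pos_right hn haa.le

/-- The inverse metric density `|g|^{1/2} g^{jk}`. -/
def densMetric (φ : Plane → Amb m) (j k : Fin 2) (x : Plane) : ℝ :=
  sqrtG φ x * invMetric φ x j k

theorem invMetric_comm (φ : Plane → Amb m) (x : Plane) (i j : Fin 2) :
    invMetric φ x i j = invMetric φ x j i := by
  have h : (metric φ x).transpose = metric φ x := Matrix.ext fun i j => metric_comm φ x j i
  have h' := Matrix.transpose_nonsing_inv (metric φ x)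
  rw [h] at h'
  exact congrFun (congrFun h' j) i

theorem densMetric_comm (φ : Plane → Amb m) (i j : Fin 2) (x : Plane) :
    densMetric φ i j x = densMetric φ j i x := by
  rw [densMetric, densMetric, invMetric_comm]

theorem sqrtG_smul_grad (φ : Plane → Amb m) (f : Plane → V) (j : Fin 2) (x : Plane) :
    sqrtG φ x • grad φ f j x = densMetric φ j 0 x • pd 0 f x + densMetric φ j 1 x • pd 1 f x := by
  simp only [grad, densMetric, Fin.sum_univ_two, smul_add, mul_smul]

/-- Two vectors which differ by a tangent vector and have the same inner products with the tangent
vectors are equal. -/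
theorem eq_of_sub_mem_span_of_inner_eq {v w a b : Amb m} {c d : ℝ} (h : v = w + c • a + d • b)
    (ha : inner ℝ v a = inner ℝ w a) (hb : inner ℝ v b = inner ℝ w b) : v = w := by
  have h1 : v - w = c • a + d • b := by rw [h]; module
  have h2 : inner ℝ (v - w) (v - w) = (0 : ℝ) := by
    conv_lhs => arg 3; rw [h1]
    rw [inner_add_right, inner_smul_right, inner_smul_right, inner_sub_left, inner_sub_left, ha, hb]
    simp
  exact sub_eq_zero.1 (inner_self_eq_zero.1 h2)

end

namespace IsImmersedOn

variable {V : Type*} [NormedAddCommGroup V] [NormedSpace ℝ V] {m : ℕ} {φ : Plane → Amb m}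
  {U : Set Plane} {x : Plane}

theorem mono {U' : Set Plane} (h : IsImmersedOn φ U) (hU' : IsOpen U') (hsub : U' ⊆ U) :
    IsImmersedOn φ U' :=
  ⟨hU', h.contDiffOn.mono hsub, fun x hx => h.det_pos x (hsub hx)⟩

theorem sqrtG_pos (h : IsImmersedOn φ U) (hx : x ∈ U) : 0 < sqrtG φ x :=
  Real.sqrt_pos.2 (h.det_pos x hx)

theorem sqrtG_mul_self (h : IsImmersedOn φ U) (hx : x ∈ U) :
    sqrtG φ x * sqrtG φ x
      = metric φ x 0 0 * metric φ x 1 1 - metric φ x 0 1 * metric φ x 0 1 := by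
  rw [sqrtG, Real.mul_self_sqrt (h.det_pos x hx).le, det_metric]

theorem metric_mul_invMetric (h : IsImmersedOn φ U) (hx : x ∈ U) :
    metric φ x * invMetric φ x = 1 :=
  Matrix.mul_nonsing_inv _ (isUnit_iff_ne_zero.2 (h.det_pos x hx).ne')

theorem sum_metric_mul_invMetric (h : IsImmersedOn φ U) (hx : x ∈ U) (i j : Fin 2) :
    metric φ x i 0 * invMetric φ x 0 j + metric φ x i 1 * invMetric φ x 1 j
      = if i = j then 1 else 0 := by
  have := congrFun (congrFun (h.metric_mul_invMetric hx) i) j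
  rwa [Matrix.mul_apply, Fin.sum_univ_two, Matrix.one_apply] at this

theorem invMetric_eq (h : IsImmersedOn φ U) (hx : x ∈ U) :
    invMetric φ x 0 0 = metric φ x 1 1 / (sqrtG φ x * sqrtG φ x) ∧
    invMetric φ x 0 1 = -metric φ x 0 1 / (sqrtG φ x * sqrtG φ x) ∧
    invMetric φ x 1 0 = -metric φ x 0 1 / (sqrtG φ x * sqrtG φ x) ∧
    invMetric φ x 1 1 = metric φ x 0 0 / (sqrtG φ x * sqrtG φ x) := by
  have hs : sqrtG φ x * sqrtG φ x = (metric φ x).det := Real.mul_self_sqrt (h.det_pos x hx).le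
  simp only [invMetric, Matrix.inv_def, Ring.inverse_eq_inv', Matrix.adjugate_fin_two,
    Matrix.smul_apply, smul_eq_mul, hs, metric_comm φ x 1 0]
  simp [div_eq_inv_mul]

theorem densMetric_eq (h : IsImmersedOn φ U) (hx : x ∈ U) :
    densMetric φ 0 0 x = metric φ x 1 1 / sqrtG φ x ∧
    densMetric φ 0 1 x = -metric φ x 0 1 / sqrtG φ x ∧
    densMetric φ 1 0 x = -metric φ x 0 1 / sqrtG φ x ∧
    densMetric φ 1 1 x = metric φ x 0 0 / sqrtG φ x := by
  have hs := (h.sqrtG_pos hx).ne'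
  obtain ⟨h1, h2, h3, h4⟩ := h.invMetric_eq hx
  simp only [densMetric, h1, h2, h3, h4]
  refine ⟨?_, ?_, ?_, ?_⟩ <;> field_simp

theorem sum_densMetric_mul_metric (h : IsImmersedOn φ U) (hx : x ∈ U) (i j : Fin 2) :
    densMetric φ i 0 x * metric φ x 0 j + densMetric φ i 1 x * metric φ x 1 j
      = if i = j then sqrtG φ x else 0 := by
  have h1 := h.sum_metric_mul_invMetric hx j i
  simp only [invMetric_comm φ x _ i, metric_comm φ x j] at h1
  have h2 : densMetric φ i 0 x * metric φ x 0 j + densMetric φ i 1 x * metric φ x 1 j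
      = sqrtG φ x * if j = i then 1 else 0 := by
    rw [← h1, densMetric, densMetric]; ring
  rw [h2]
  simp [eq_comm]

/-! ### Smoothness -/

theorem contDiffOn_pd (h : IsImmersedOn φ U) (i : Fin 2) : ContDiffOn ℝ ∞ (pd i φ) U :=
  ContDiffOn.pd i h.isOpen h.contDiffOn

theorem contDiffOn_metric (h : IsImmersedOn φ U) (i j : Fin 2) :
    ContDiffOn ℝ ∞ (fun y => metric φ y i j) U :=
  (h.contDiffOn_pd i).inner ℝ (h.contDiffOn_pd j)

theorem contDiffOn_sqrtG (h : IsImmersedOn φ U) : ContDiffOn ℝ ∞ (sqrtG φ) U := by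
  refine ContDiffOn.sqrt ?_ fun x hx => (h.det_pos x hx).ne'
  simp only [det_metric]
  exact ((h.contDiffOn_metric 0 0).mul (h.contDiffOn_metric 1 1)).sub
    ((h.contDiffOn_metric 0 1).mul (h.contDiffOn_metric 0 1))

theorem contDiffOn_invMetric (h : IsImmersedOn φ U) (i j : Fin 2) :
    ContDiffOn ℝ ∞ (fun y => invMetric φ y i j) U := by
  have hs := h.contDiffOn_sqrtG.mul h.contDiffOn_sqrtG
  have hs0 : ∀ x ∈ U, sqrtG φ x * sqrtG φ x ≠ 0 := fun x hx =>
    mul_ne_zero (h.sqrtG_pos hx).ne' (h.sqrtG_pos hx).ne'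
  fin_cases i <;> fin_cases j
  · exact ((h.contDiffOn_metric 1 1).div hs hs0).congr fun y hy => (h.invMetric_eq hy).1
  · exact ((h.contDiffOn_metric 0 1).neg.div hs hs0).congr fun y hy => (h.invMetric_eq hy).2.1
  · exact ((h.contDiffOn_metric 0 1).neg.div hs hs0).congr fun y hy => (h.invMetric_eq hy).2.2.1
  · exact ((h.contDiffOn_metric 0 0).div hs hs0).congr fun y hy => (h.invMetric_eq hy).2.2.2

theorem contDiffOn_densMetric (h : IsImmersedOn φ U) (i j : Fin 2) :
    ContDiffOn ℝ ∞ (densMetric φ i j) U :=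
  h.contDiffOn_sqrtG.mul (h.contDiffOn_invMetric i j)

theorem contDiffOn_grad (h : IsImmersedOn φ U) {f : Plane → V} (hf : ContDiffOn ℝ ∞ f U)
    (j : Fin 2) : ContDiffOn ℝ ∞ (grad φ f j) U :=
  ContDiffOn.sum fun k _ => (h.contDiffOn_invMetric j k).smul (ContDiffOn.pd k h.isOpen hf)

theorem contDiffOn_christoffel (h : IsImmersedOn φ U) (k i j : Fin 2) :
    ContDiffOn ℝ ∞ (christoffel φ k i j) U :=
  contDiffOn_const.mul <| ContDiffOn.sum fun l _ => (h.contDiffOn_invMetric k l).mul <|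
    ((ContDiffOn.pd i h.isOpen (h.contDiffOn_metric j l)).add
      (ContDiffOn.pd j h.isOpen (h.contDiffOn_metric i l))).sub
      (ContDiffOn.pd l h.isOpen (h.contDiffOn_metric i j))

theorem contDiffOn_sff (h : IsImmersedOn φ U) (i j : Fin 2) : ContDiffOn ℝ ∞ (sff φ i j) U :=
  (ContDiffOn.pd i h.isOpen (h.contDiffOn_pd j)).sub <| ContDiffOn.sum fun k _ =>
    (h.contDiffOn_christoffel k i j).smul (h.contDiffOn_pd k)

theorem contDiffOn_sffUp (h : IsImmersedOn φ U) (i j : Fin 2) :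
    ContDiffOn ℝ ∞ (sffUp φ i j) U :=
  ContDiffOn.sum fun a _ => ContDiffOn.sum fun b _ =>
    ((h.contDiffOn_invMetric i a).mul (h.contDiffOn_invMetric j b)).smul (h.contDiffOn_sff a b)

theorem contDiffOn_meanCurv (h : IsImmersedOn φ U) : ContDiffOn ℝ ∞ (meanCurv φ) U :=
  ContDiffOn.const_smul (1 / 2 : ℝ) <| ContDiffOn.sum fun i _ => ContDiffOn.sum fun j _ =>
    (h.contDiffOn_invMetric i j).smul (h.contDiffOn_sff i j)

/-! ### The second fundamental form -/

theorem differentiableAt (h : IsImmersedOn φ U) {f : Plane → V} (hf : ContDiffOn ℝ ∞ f U)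
    (hx : x ∈ U) : DifferentiableAt ℝ f x :=
  differentiableAt_of_contDiffOn h.isOpen hf hx

theorem pd_pd_comm (h : IsImmersedOn φ U) (hx : x ∈ U) (i j : Fin 2) :
    pd i (pd j φ) x = pd j (pd i φ) x :=
  pd_comm i j h.isOpen h.contDiffOn hx

theorem pd_metric (h : IsImmersedOn φ U) (hx : x ∈ U) (l i j : Fin 2) :
    pd l (fun y => metric φ y i j) x
      = inner ℝ (pd l (pd i φ) x) (pd j φ x) + inner ℝ (pd i φ x) (pd l (pd j φ) x) :=
  pd_inner l (h.differentiableAt (h.contDiffOn_pd i) hx)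
    (h.differentiableAt (h.contDiffOn_pd j) hx)

/-- The Christoffel symbols of the first kind are the tangential components of `∂ᵢ∂ⱼφ`. -/
theorem sum_christoffel_mul_metric (h : IsImmersedOn φ U) (hx : x ∈ U) (i j l : Fin 2) :
    christoffel φ 0 i j x * metric φ x 0 l + christoffel φ 1 i j x * metric φ x 1 l
      = inner ℝ (pd i (pd j φ) x) (pd l φ x) := by
  have hk (p : Fin 2) : (pd i (fun y => metric φ y j p) x + pd j (fun y => metric φ y i p) x
      - pd p (fun y => metric φ y i j) x) = 2 * inner ℝ (pd i (pd j φ) x) (pd p φ x) := by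
    rw [h.pd_metric hx, h.pd_metric hx, h.pd_metric hx, h.pd_pd_comm hx j i,
      h.pd_pd_comm hx p i, h.pd_pd_comm hx p j, real_inner_comm (pd i (pd p φ) x)]
    ring
  have h0 := h.sum_metric_mul_invMetric hx l 0
  have h1 := h.sum_metric_mul_invMetric hx l 1
  simp only [christoffel, hk, Fin.sum_univ_two, metric_comm φ x _ l]
  fin_cases l
  · simp at h0 h1 ⊢
    linear_combination inner ℝ (pd i (pd j φ) x) (pd 0 φ x) * h0
      + inner ℝ (pd i (pd j φ) x) (pd 1 φ x) * h1
  · simp at h0 h1 ⊢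
    linear_combination inner ℝ (pd i (pd j φ) x) (pd 0 φ x) * h0
      + inner ℝ (pd i (pd j φ) x) (pd 1 φ x) * h1

theorem inner_sff_pd (h : IsImmersedOn φ U) (hx : x ∈ U) (i j l : Fin 2) :
    inner ℝ (sff φ i j x) (pd l φ x) = (0 : ℝ) := by
  rw [sff, inner_sub_left, Fin.sum_univ_two, inner_add_left, real_inner_smul_left,
    real_inner_smul_left, ← h.sum_christoffel_mul_metric hx i j l]
  simp only [metric_apply]
  ring

theorem pd_pd_eq (φ : Plane → Amb m) (x : Plane) (i j : Fin 2) :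
    pd i (pd j φ) x = sff φ i j x + christoffel φ 0 i j x • pd 0 φ x
      + christoffel φ 1 i j x • pd 1 φ x := by
  rw [sff, Fin.sum_univ_two]; module

/-- Second partial derivatives commute, so the two sides differ by a tangent vector; both are
normal. The symmetry of the Christoffel symbols need not be computed. -/
theorem sff_comm (h : IsImmersedOn φ U) (hx : x ∈ U) (i j : Fin 2) :
    sff φ i j x = sff φ j i x := by
  refine eq_of_sub_mem_span_of_inner_eq (a := pd 0 φ x) (b := pd 1 φ x)
    (c := christoffel φ 0 j i x - christoffel φ 0 i j x)
    (d := christoffel φ 1 j i x - christoffel φ 1 i j x) ?_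
    (by rw [h.inner_sff_pd hx, h.inner_sff_pd hx]) (by rw [h.inner_sff_pd hx, h.inner_sff_pd hx])
  have h1 := pd_pd_eq φ x i j
  rw [h.pd_pd_comm hx i j, pd_pd_eq φ x j i] at h1
  linear_combination (norm := module) -h1

theorem inner_meanCurv_pd (h : IsImmersedOn φ U) (hx : x ∈ U) (l : Fin 2) :
    inner ℝ (meanCurv φ x) (pd l φ x) = (0 : ℝ) := by
  simp only [meanCurv, Fin.sum_univ_two, real_inner_smul_left, inner_add_left,
    h.inner_sff_pd hx, mul_zero, add_zero]

theorem inner_meanCurv_pd_pd (h : IsImmersedOn φ U) (hx : x ∈ U) (i j : Fin 2) :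
    inner ℝ (meanCurv φ x) (pd i (pd j φ) x) = inner ℝ (meanCurv φ x) (sff φ i j x) := by
  rw [pd_pd_eq, inner_add_right, inner_add_right, inner_smul_right, inner_smul_right,
    h.inner_meanCurv_pd hx, h.inner_meanCurv_pd hx]
  ring

/-- Weingarten's relation, from differentiating `H · ∂ⱼφ = 0`. -/
theorem inner_pd_meanCurv_pd (h : IsImmersedOn φ U) (hx : x ∈ U) (i j : Fin 2) :
    inner ℝ (pd i (meanCurv φ) x) (pd j φ x) = -inner ℝ (meanCurv φ x) (sff φ i j x) := by
  have h1 := pd_inner i (h.differentiableAt h.contDiffOn_meanCurv hx)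
    (h.differentiableAt (h.contDiffOn_pd j) hx)
  rw [pd_congr i h.isOpen (g := fun _ => 0) (fun y hy => h.inner_meanCurv_pd hy j) hx, pd_const,
    h.inner_meanCurv_pd_pd hx] at h1
  linarith

/-! ### The Laplace-Beltrami operator -/

theorem sqrtG_smul_divg (h : IsImmersedOn φ U) (hx : x ∈ U) (F : Fin 2 → Plane → V) :
    sqrtG φ x • divg φ F x
      = pd 0 (fun y => sqrtG φ y • F 0 y) x + pd 1 (fun y => sqrtG φ y • F 1 y) x := by
  rw [divg, smul_inv_smul₀ (h.sqrtG_pos hx).ne', Fin.sum_univ_two]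

theorem sqrtG_smul_lap (h : IsImmersedOn φ U) (hx : x ∈ U) (f : Plane → V) :
    sqrtG φ x • lap φ f x
      = pd 0 (fun y => densMetric φ 0 0 y • pd 0 f y + densMetric φ 0 1 y • pd 1 f y) x
        + pd 1 (fun y => densMetric φ 1 0 y • pd 0 f y + densMetric φ 1 1 y • pd 1 f y) x := by
  rw [lap, h.sqrtG_smul_divg hx]
  simp only [sqrtG_smul_grad]

theorem pd_dens_smul_pd (h : IsImmersedOn φ U) (hx : x ∈ U) {f : Plane → V}
    (hf : ContDiffOn ℝ ∞ f U) (l j : Fin 2) :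
    pd l (fun y => densMetric φ j 0 y • pd 0 f y + densMetric φ j 1 y • pd 1 f y) x
      = pd l (densMetric φ j 0) x • pd 0 f x + densMetric φ j 0 x • pd l (pd 0 f) x
        + (pd l (densMetric φ j 1) x • pd 1 f x + densMetric φ j 1 x • pd l (pd 1 f) x) := by
  have hd (k : Fin 2) := h.differentiableAt (h.contDiffOn_densMetric j k) hx
  have hp (k : Fin 2) := h.differentiableAt (ContDiffOn.pd k h.isOpen hf) hx
  rw [pd_add l ((hd 0).fun_smul (hp 0)) ((hd 1).fun_smul (hp 1)), pd_smul l (hd 0) (hp 0),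
    pd_smul l (hd 1) (hp 1)]

theorem sqrtG_smul_lap_expand (h : IsImmersedOn φ U) (hx : x ∈ U) {f : Plane → V}
    (hf : ContDiffOn ℝ ∞ f U) :
    sqrtG φ x • lap φ f x
      = pd 0 (densMetric φ 0 0) x • pd 0 f x + densMetric φ 0 0 x • pd 0 (pd 0 f) x
        + (pd 0 (densMetric φ 0 1) x • pd 1 f x + densMetric φ 0 1 x • pd 0 (pd 1 f) x)
        + (pd 1 (densMetric φ 1 0) x • pd 0 f x + densMetric φ 1 0 x • pd 1 (pd 0 f) x
        + (pd 1 (densMetric φ 1 1) x • pd 1 f x + densMetric φ 1 1 x • pd 1 (pd 1 f) x)) := by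
  rw [h.sqrtG_smul_lap hx, h.pd_dens_smul_pd hx hf, h.pd_dens_smul_pd hx hf]

/-- Jacobi's formula for the derivative of the area density. -/
theorem pd_sqrtG (h : IsImmersedOn φ U) (hx : x ∈ U) (l : Fin 2) :
    2 * sqrtG φ x * pd l (sqrtG φ) x
      = pd l (fun y => metric φ y 0 0) x * metric φ x 1 1
        + metric φ x 0 0 * pd l (fun y => metric φ y 1 1) x
        - 2 * metric φ x 0 1 * pd l (fun y => metric φ y 0 1) x := by
  have hs := h.differentiableAt h.contDiffOn_sqrtG hx
  have hg (i j : Fin 2) := h.differentiableAt (h.contDiffOn_metric i j) hx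
  have h1 := pd_congr l h.isOpen (fun y hy => h.sqrtG_mul_self hy) hx
  rw [pd_mul l hs hs, pd_sub l ((hg 0 0).fun_mul (hg 1 1)) ((hg 0 1).fun_mul (hg 0 1)),
    pd_mul l (hg 0 0) (hg 1 1), pd_mul l (hg 0 1) (hg 0 1)] at h1
  linear_combination h1

/-- In dimension two `|g|^{1/2}` times the density `|g|^{1/2} g^{jk}` is the adjugate of the metric,
whose entries are linear in `g`. This is the differentiated form of that relation. -/
theorem pd_sqrtG_mul_densMetric (h : IsImmersedOn φ U) (hx : x ∈ U) (l : Fin 2) :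
    pd l (sqrtG φ) x * densMetric φ 0 0 x + sqrtG φ x * pd l (densMetric φ 0 0) x
        = pd l (fun y => metric φ y 1 1) x ∧
    pd l (sqrtG φ) x * densMetric φ 0 1 x + sqrtG φ x * pd l (densMetric φ 0 1) x
        = -pd l (fun y => metric φ y 0 1) x ∧
    pd l (sqrtG φ) x * densMetric φ 1 1 x + sqrtG φ x * pd l (densMetric φ 1 1) x
        = pd l (fun y => metric φ y 0 0) x := by
  have hs := h.differentiableAt h.contDiffOn_sqrtG hx
  have hd (i j : Fin 2) := h.differentiableAt (h.contDiffOn_densMetric i j) hx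
  refine ⟨?_, ?_, ?_⟩
  · rw [← pd_mul l hs (hd 0 0)]
    refine pd_congr l h.isOpen (fun y hy => ?_) hx
    rw [(h.densMetric_eq hy).1, mul_div_cancel₀ _ (h.sqrtG_pos hy).ne']
  · rw [← pd_mul l hs (hd 0 1), ← pd_neg]
    refine pd_congr l h.isOpen (fun y hy => ?_) hx
    rw [(h.densMetric_eq hy).2.1, mul_div_cancel₀ _ (h.sqrtG_pos hy).ne']
  · rw [← pd_mul l hs (hd 1 1)]
    refine pd_congr l h.isOpen (fun y hy => ?_) hx
    rw [(h.densMetric_eq hy).2.2.2, mul_div_cancel₀ _ (h.sqrtG_pos hy).ne']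

theorem two_smul_sqrtG_meanCurv (h : IsImmersedOn φ U) (hx : x ∈ U) :
    (2 * sqrtG φ x) • meanCurv φ x = densMetric φ 0 0 x • sff φ 0 0 x
      + (2 * densMetric φ 0 1 x) • sff φ 0 1 x + densMetric φ 1 1 x • sff φ 1 1 x := by
  simp only [meanCurv, Fin.sum_univ_two, h.sff_comm hx 1 0, invMetric_comm φ x 1 0, densMetric]
  module

/-- The Laplacian of an immersion is twice its mean curvature vector. -/
theorem lap_self (h : IsImmersedOn φ U) (hx : x ∈ U) :
    lap φ φ x = (2 : ℝ) • meanCurv φ x := by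
  have hs := (h.sqrtG_pos hx).ne'
  suffices sqrtG φ x • lap φ φ x = (2 * sqrtG φ x) • meanCurv φ x by
    rw [mul_comm, mul_smul] at this
    exact smul_right_injective _ hs this
  have hexp := h.sqrtG_smul_lap_expand hx h.contDiffOn
  have hH := h.two_smul_sqrtG_meanCurv hx
  rw [densMetric_comm φ 1 0, show densMetric φ 1 0 = densMetric φ 0 1 from
    funext (densMetric_comm φ 1 0), h.pd_pd_comm hx 1 0] at hexp
  -- The two sides agree up to a tangent vector, so it remains to see that `Δφ` has no tangential
  -- part.
  have htan (l : Fin 2) : inner ℝ (sqrtG φ x • lap φ φ x) (pd l φ x)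
      = inner ℝ ((2 * sqrtG φ x) • meanCurv φ x) (pd l φ x) := by
    rw [real_inner_smul_left (meanCurv φ x), h.inner_meanCurv_pd hx, mul_zero, hexp]
    simp only [inner_add_left, real_inner_smul_left]
    obtain ⟨a1, a2, a3⟩ := h.pd_sqrtG_mul_densMetric hx 0
    obtain ⟨b1, b2, b3⟩ := h.pd_sqrtG_mul_densMetric hx 1
    have c0 := h.pd_sqrtG hx 0
    have c1 := h.pd_sqrtG hx 1
    obtain ⟨d1, d2, -, d4⟩ := h.densMetric_eq hx
    have hss := h.sqrtG_mul_self hx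
    simp only [h.pd_metric hx, h.pd_pd_comm hx 1 0] at a1 a2 a3 b1 b2 b3 c0 c1
    simp only [metric_apply] at hss c0 c1 d1 d2 d4
    have hc (i j k : Fin 2) : inner ℝ (pd i φ x) (pd j (pd k φ) x)
        = (inner ℝ (pd j (pd k φ) x) (pd i φ x) : ℝ) := real_inner_comm _ _
    have hc' : inner ℝ (pd 1 φ x) (pd 0 φ x) = (inner ℝ (pd 0 φ x) (pd 1 φ x) : ℝ) :=
      real_inner_comm _ _
    rw [eq_div_iff hs] at d1 d2 d4
    simp only [hc] at a1 a2 a3 b1 b2 b3 c0 c1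
    -- An extra factor `|g|^{1/2}` turns derivatives of the densities into derivatives of the metric
    -- coefficients.
    refine (mul_eq_zero.1 ?_).resolve_left hs
    fin_cases l
    · simp only [Fin.zero_eta, Fin.isValue, hc']
      have r1 := h.sum_densMetric_mul_metric hx 0 0
      have r2 := h.sum_densMetric_mul_metric hx 1 0
      simp [densMetric_comm φ 1 0] at r1 r2
      simp only [metric_apply, hc'] at r1 r2
      linear_combination inner ℝ (pd 0 φ x) (pd 0 φ x) * (a1 + b2)
        + inner ℝ (pd 0 φ x) (pd 1 φ x) * (a2 + b3) - pd 0 (sqrtG φ) x * r1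
        - pd 1 (sqrtG φ) x * r2 - c0 / 2 + inner ℝ (pd 0 (pd 0 φ) x) (pd 0 φ x) * d1
        + 2 * inner ℝ (pd 0 (pd 1 φ) x) (pd 0 φ x) * d2
        + inner ℝ (pd 1 (pd 1 φ) x) (pd 0 φ x) * d4
    · simp only [Fin.mk_one, Fin.isValue]
      have r1 := h.sum_densMetric_mul_metric hx 0 1
      have r2 := h.sum_densMetric_mul_metric hx 1 1
      simp [densMetric_comm φ 1 0] at r1 r2
      simp only [metric_apply] at r1 r2
      linear_combination inner ℝ (pd 0 φ x) (pd 1 φ x) * (a1 + b2)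
        + inner ℝ (pd 1 φ x) (pd 1 φ x) * (a2 + b3) - pd 0 (sqrtG φ) x * r1
        - pd 1 (sqrtG φ) x * r2 - c1 / 2 + inner ℝ (pd 0 (pd 0 φ) x) (pd 1 φ x) * d1
        + 2 * inner ℝ (pd 0 (pd 1 φ) x) (pd 1 φ x) * d2
        + inner ℝ (pd 1 (pd 1 φ) x) (pd 1 φ x) * d4
  refine eq_of_sub_mem_span_of_inner_eq (a := pd 0 φ x) (b := pd 1 φ x)
    (c := pd 0 (densMetric φ 0 0) x + pd 1 (densMetric φ 0 1) x
      + densMetric φ 0 0 x * christoffel φ 0 0 0 x + 2 * densMetric φ 0 1 x * christoffel φ 0 0 1 x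
      + densMetric φ 1 1 x * christoffel φ 0 1 1 x)
    (d := pd 0 (densMetric φ 0 1) x + pd 1 (densMetric φ 1 1) x
      + densMetric φ 0 0 x * christoffel φ 1 0 0 x + 2 * densMetric φ 0 1 x * christoffel φ 1 0 1 x
      + densMetric φ 1 1 x * christoffel φ 1 1 1 x) ?_ (htan 0) (htan 1)
  rw [hexp, hH, pd_pd_eq φ x 0 0, pd_pd_eq φ x 0 1, pd_pd_eq φ x 1 1]
  module

end IsImmersedOn

/-! ### The projection onto the normal space -/

section

variable {m : ℕ} {φ : Plane → Amb m} {x : Plane}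

theorem projN_eq_of_inner_eq_zero {v n : Amb m} {c d : ℝ}
    (hv : v = n + c • pd 0 φ x + d • pd 1 φ x) (h0 : inner ℝ n (pd 0 φ x) = (0 : ℝ))
    (h1 : inner ℝ n (pd 1 φ x) = (0 : ℝ)) : projN φ x v = n := by
  have hn : n ∈ (LinearMap.range (fderiv ℝ φ x).toLinearMap)ᗮ := by
    rw [Submodule.mem_orthogonal']
    rintro _ ⟨u, rfl⟩
    have hu : u = u 0 • EuclideanSpace.single (0 : Fin 2) (1 : ℝ)
        + u 1 • EuclideanSpace.single (1 : Fin 2) (1 : ℝ) := by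
      ext k; fin_cases k <;> simp
    have h : fderiv ℝ φ x u = u 0 • pd 0 φ x + u 1 • pd 1 φ x := by
      conv_lhs => rw [hu]
      simp [pd]
    change inner ℝ n (fderiv ℝ φ x u) = (0 : ℝ)
    rw [h, inner_add_right, inner_smul_right, inner_smul_right, h0, h1]
    simp
  have ht (i : Fin 2) : pd i φ x ∈ LinearMap.range (fderiv ℝ φ x).toLinearMap := ⟨_, rfl⟩
  have hP (i : Fin 2) : projN φ x (pd i φ x) = 0 :=
    (Submodule.starProjection_apply_eq_zero_iff _).2
      (Submodule.le_orthogonal_orthogonal _ (ht i))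
  have hPn : projN φ x n = n := Submodule.starProjection_eq_self_iff.2 hn
  simp only [projN] at hP hPn ⊢
  rw [hv, map_add, map_add, map_smul, map_smul, hP, hP, hPn]
  simp

end

/-- The tangential field `(H · h^{jk}) ∂ₖφ`, the opposite of the tangential part of `∇ʲH`. -/
def shapeField {m : ℕ} (φ : Plane → Amb m) (j : Fin 2) (x : Plane) : Amb m :=
  ∑ k, inner ℝ (meanCurv φ x) (sffUp φ j k x) • pd k φ x

namespace IsImmersedOn

variable {V : Type*} [NormedAddCommGroup V] [NormedSpace ℝ V] {m : ℕ} {φ : Plane → Amb m}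
  {U : Set Plane} {x : Plane}

/-! ### The covariant divergence -/

theorem eq_of_sqrtG_smul_eq (h : IsImmersedOn φ U) (hx : x ∈ U) {v w : V}
    (hvw : sqrtG φ x • v = sqrtG φ x • w) : v = w :=
  smul_right_injective _ (h.sqrtG_pos hx).ne' hvw

theorem divg_congr (h : IsImmersedOn φ U) (hx : x ∈ U) {F G : Fin 2 → Plane → V}
    (hFG : ∀ j, ∀ y ∈ U, F j y = G j y) : divg φ F x = divg φ G x := by
  refine h.eq_of_sqrtG_smul_eq hx ?_
  rw [h.sqrtG_smul_divg hx, h.sqrtG_smul_divg hx,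
    pd_congr 0 h.isOpen (g := fun y => sqrtG φ y • G 0 y) (fun y hy => by rw [hFG 0 y hy]) hx,
    pd_congr 1 h.isOpen (g := fun y => sqrtG φ y • G 1 y) (fun y hy => by rw [hFG 1 y hy]) hx]

theorem divg_expand (h : IsImmersedOn φ U) (hx : x ∈ U) {F : Fin 2 → Plane → V}
    (hF : ∀ j, ContDiffOn ℝ ∞ (F j) U) :
    sqrtG φ x • divg φ F x = pd 0 (sqrtG φ) x • F 0 x + sqrtG φ x • pd 0 (F 0) x
      + (pd 1 (sqrtG φ) x • F 1 x + sqrtG φ x • pd 1 (F 1) x) := by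
  have hs := h.differentiableAt h.contDiffOn_sqrtG hx
  rw [h.sqrtG_smul_divg hx, pd_smul 0 hs (h.differentiableAt (hF 0) hx),
    pd_smul 1 hs (h.differentiableAt (hF 1) hx)]

theorem divg_add (h : IsImmersedOn φ U) (hx : x ∈ U) {F G : Fin 2 → Plane → V}
    (hF : ∀ j, ContDiffOn ℝ ∞ (F j) U) (hG : ∀ j, ContDiffOn ℝ ∞ (G j) U) :
    divg φ (fun j y => F j y + G j y) x = divg φ F x + divg φ G x := by
  refine h.eq_of_sqrtG_smul_eq hx ?_
  rw [smul_add, h.divg_expand hx hF, h.divg_expand hx hG,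
    h.divg_expand hx fun j => (hF j).add (hG j),
    pd_add 0 (h.differentiableAt (hF 0) hx) (h.differentiableAt (hG 0) hx),
    pd_add 1 (h.differentiableAt (hF 1) hx) (h.differentiableAt (hG 1) hx)]
  module

theorem divg_smul (h : IsImmersedOn φ U) (hx : x ∈ U) {c : Plane → ℝ} {F : Fin 2 → Plane → V}
    (hc : ContDiffOn ℝ ∞ c U) (hF : ∀ j, ContDiffOn ℝ ∞ (F j) U) :
    divg φ (fun j y => c y • F j y) x
      = pd 0 c x • F 0 x + pd 1 c x • F 1 x + c x • divg φ F x := by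
  refine h.eq_of_sqrtG_smul_eq hx ?_
  have hc' := h.differentiableAt hc hx
  rw [smul_add, smul_comm _ (c x), h.divg_expand hx hF,
    h.divg_expand hx (F := fun j y => c y • F j y) fun j => hc.smul (hF j),
    pd_smul 0 hc' (h.differentiableAt (hF 0) hx), pd_smul 1 hc' (h.differentiableAt (hF 1) hx)]
  module

/-- The product rule `∇ⱼ(fʲ u) = (∇ⱼfʲ) u + fʲ ∂ⱼu`. -/
theorem divg_smul_right (h : IsImmersedOn φ U) (hx : x ∈ U) {c : Fin 2 → Plane → ℝ}
    {u : Plane → V} (hc : ∀ j, ContDiffOn ℝ ∞ (c j) U) (hu : ContDiffOn ℝ ∞ u U) :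
    divg φ (fun j y => c j y • u y) x
      = divg φ c x • u x + (c 0 x • pd 0 u x + c 1 x • pd 1 u x) := by
  refine h.eq_of_sqrtG_smul_eq hx ?_
  have hu' := h.differentiableAt hu hx
  rw [smul_add, ← smul_assoc, h.divg_expand hx hc,
    h.divg_expand hx (F := fun j y => c j y • u y) fun j => (hc j).smul hu,
    pd_smul 0 (h.differentiableAt (hc 0) hx) hu', pd_smul 1 (h.differentiableAt (hc 1) hx) hu']
  simp only [smul_eq_mul]
  module

theorem divg_const_smul (h : IsImmersedOn φ U) (hx : x ∈ U) (c : ℝ) {F : Fin 2 → Plane → V}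
    (hF : ∀ j, ContDiffOn ℝ ∞ (F j) U) :
    divg φ (fun j y => c • F j y) x = c • divg φ F x := by
  rw [h.divg_smul hx contDiffOn_const hF, pd_const, pd_const]
  simp

theorem divg_inner (h : IsImmersedOn φ U) (hx : x ∈ U) {F : Fin 2 → Plane → Amb m}
    {u : Plane → Amb m} (hF : ∀ j, ContDiffOn ℝ ∞ (F j) U) (hu : ContDiffOn ℝ ∞ u U) :
    divg φ (fun j y => (inner ℝ (F j y) (u y) : ℝ)) x
      = inner ℝ (divg φ F x) (u x)
        + (inner ℝ (F 0 x) (pd 0 u x) + inner ℝ (F 1 x) (pd 1 u x)) := by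
  refine h.eq_of_sqrtG_smul_eq hx ?_
  have hu' := h.differentiableAt hu hx
  rw [smul_add, smul_eq_mul (sqrtG φ x) (inner ℝ (divg φ F x) (u x)), ← real_inner_smul_left,
    h.divg_expand hx hF, h.divg_expand hx fun j => (hF j).inner ℝ hu,
    pd_inner 0 (h.differentiableAt (hF 0) hx) hu', pd_inner 1 (h.differentiableAt (hF 1) hx) hu']
  simp only [inner_add_left, real_inner_smul_left, smul_eq_mul]
  ring

theorem contDiffOn_shapeField (h : IsImmersedOn φ U) (j : Fin 2) :
    ContDiffOn ℝ ∞ (shapeField φ j) U :=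
  ContDiffOn.sum fun k _ =>
    (h.contDiffOn_meanCurv.inner ℝ (h.contDiffOn_sffUp j k)).smul (h.contDiffOn_pd k)

/-! ### Contractions of the second fundamental form -/

theorem inner_sffUp_mul_metric (h : IsImmersedOn φ U) (hx : x ∈ U) (v : Amb m) (j l : Fin 2) :
    inner ℝ v (sffUp φ j 0 x) * metric φ x 0 l + inner ℝ v (sffUp φ j 1 x) * metric φ x 1 l
      = invMetric φ x j 0 * inner ℝ v (sff φ 0 l x)
        + invMetric φ x j 1 * inner ℝ v (sff φ 1 l x) := by
  have h0 := h.sum_metric_mul_invMetric hx l 0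
  have h1 := h.sum_metric_mul_invMetric hx l 1
  simp only [sffUp, Fin.sum_univ_two, inner_add_right, inner_smul_right, metric_comm φ x _ l,
    invMetric_comm φ x 1 0] at h0 h1 ⊢
  fin_cases l
  · simp at h0 h1 ⊢
    linear_combination (invMetric φ x j 0 * inner ℝ v (sff φ 0 0 x)
        + invMetric φ x j 1 * inner ℝ v (sff φ 1 0 x)) * h0
      + (invMetric φ x j 0 * inner ℝ v (sff φ 0 1 x)
        + invMetric φ x j 1 * inner ℝ v (sff φ 1 1 x)) * h1
  · simp at h0 h1 ⊢
    linear_combination (invMetric φ x j 0 * inner ℝ v (sff φ 0 0 x)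
        + invMetric φ x j 1 * inner ℝ v (sff φ 1 0 x)) * h0
      + (invMetric φ x j 0 * inner ℝ v (sff φ 0 1 x)
        + invMetric φ x j 1 * inner ℝ v (sff φ 1 1 x)) * h1

theorem inner_grad_meanCurv_pd (h : IsImmersedOn φ U) (hx : x ∈ U) (j l : Fin 2) :
    inner ℝ (grad φ (meanCurv φ) j x) (pd l φ x)
      = -(invMetric φ x j 0 * inner ℝ (meanCurv φ x) (sff φ 0 l x)
        + invMetric φ x j 1 * inner ℝ (meanCurv φ x) (sff φ 1 l x)) := by
  simp only [grad, Fin.sum_univ_two, inner_add_left, real_inner_smul_left,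
    h.inner_pd_meanCurv_pd hx]
  ring

/-- Lowering the second index of `H · hʲᵏ` and Weingarten's relation give the same expression; hence
`∇ʲH + Aʲ` is normal. -/
theorem inner_shapeField_pd (h : IsImmersedOn φ U) (hx : x ∈ U) (j l : Fin 2) :
    inner ℝ (shapeField φ j x) (pd l φ x) = -inner ℝ (grad φ (meanCurv φ) j x) (pd l φ x) := by
  rw [h.inner_grad_meanCurv_pd hx, ← h.inner_sffUp_mul_metric hx, neg_neg]
  simp only [shapeField, Fin.sum_univ_two, inner_add_left, real_inner_smul_left, metric_apply]

/-- The normal part of `∇ʲH`. -/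
theorem projN_grad_meanCurv (h : IsImmersedOn φ U) (hx : x ∈ U) (j : Fin 2) :
    projN φ x (grad φ (meanCurv φ) j x) = grad φ (meanCurv φ) j x + shapeField φ j x := by
  refine projN_eq_of_inner_eq_zero (c := -inner ℝ (meanCurv φ x) (sffUp φ j 0 x))
    (d := -inner ℝ (meanCurv φ x) (sffUp φ j 1 x)) ?_ ?_ ?_
  · rw [shapeField, Fin.sum_univ_two]; module
  · rw [inner_add_left, h.inner_shapeField_pd hx, add_neg_cancel]
  · rw [inner_add_left, h.inner_shapeField_pd hx, add_neg_cancel]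

/-- The stress-energy tensor differs from `Fʲ` by `-∇ʲH`. -/
theorem stress_eq (h : IsImmersedOn φ U) (hx : x ∈ U) (j : Fin 2) :
    stress φ j x = chenField φ j x - grad φ (meanCurv φ) j x := by
  rw [stress, chenField, h.projN_grad_meanCurv hx]
  change _ = ‖meanCurv φ x‖ ^ 2 • grad φ φ j x - (2 : ℝ) • shapeField φ j x - _
  module

/-- The divergence of the shape field up to tangent vectors. -/
theorem exists_divg_shapeField_eq (h : IsImmersedOn φ U) (hx : x ∈ U) :
    ∃ c d : ℝ, divg φ (shapeField φ) x
      = ∑ j, ∑ k, inner ℝ (meanCurv φ x) (sffUp φ j k x) • sff φ j k x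
        + c • pd 0 φ x + d • pd 1 φ x := by
  let A (k j : Fin 2) (y : Plane) : ℝ := inner ℝ (meanCurv φ y) (sffUp φ j k y)
  have hA (k j : Fin 2) : ContDiffOn ℝ ∞ (A k j) U :=
    h.contDiffOn_meanCurv.inner ℝ (h.contDiffOn_sffUp j k)
  have h1 : divg φ (shapeField φ) x
      = divg φ (fun j y => A 0 j y • pd 0 φ y) x + divg φ (fun j y => A 1 j y • pd 1 φ y) x := by
    rw [← h.divg_add hx (F := fun j y => A 0 j y • pd 0 φ y)
      (G := fun j y => A 1 j y • pd 1 φ y) (fun j => (hA 0 j).smul (h.contDiffOn_pd 0))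
      (fun j => (hA 1 j).smul (h.contDiffOn_pd 1))]
    refine h.divg_congr hx fun j y _ => ?_
    rw [shapeField, Fin.sum_univ_two]
  rw [h1, h.divg_smul_right hx (hA 0) (h.contDiffOn_pd 0),
    h.divg_smul_right hx (hA 1) (h.contDiffOn_pd 1)]
  simp only [pd_pd_eq φ x, Fin.sum_univ_two]
  -- The witnesses collect all that multiplies a tangent vector: the divergences of the coefficients
  -- and the Christoffel parts of `∂ⱼ∂ₖφ`.
  refine ⟨divg φ (A 0) x + (A 0 0 x * christoffel φ 0 0 0 x + A 0 1 x * christoffel φ 0 1 0 x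
      + A 1 0 x * christoffel φ 0 0 1 x + A 1 1 x * christoffel φ 0 1 1 x),
    divg φ (A 1) x + (A 0 0 x * christoffel φ 1 0 0 x + A 0 1 x * christoffel φ 1 1 0 x
      + A 1 0 x * christoffel φ 1 0 1 x + A 1 1 x * christoffel φ 1 1 1 x), ?_⟩
  change _ = A 0 0 x • sff φ 0 0 x + A 1 0 x • sff φ 0 1 x
    + (A 0 1 x • sff φ 1 0 x + A 1 1 x • sff φ 1 1 x) + _ + _
  module

theorem inner_sum_smul_sff_pd (h : IsImmersedOn φ U) (hx : x ∈ U) (A : Fin 2 → Fin 2 → ℝ)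
    (l : Fin 2) : inner ℝ (∑ j, ∑ k, A j k • sff φ j k x) (pd l φ x) = (0 : ℝ) := by
  simp only [Fin.sum_univ_two, inner_add_left, real_inner_smul_left, h.inner_sff_pd hx]
  simp

/-! ### Consequences of Chen's equation -/

/-- The normal part of Chen's equation. -/
theorem lapPerp_meanCurv (h : IsImmersedOn φ U) (hx : x ∈ U) (hC : lap φ (meanCurv φ) x = 0) :
    lapPerp φ (meanCurv φ) x
      = ∑ j, ∑ k, inner ℝ (meanCurv φ x) (sffUp φ j k x) • sff φ j k x := by
  obtain ⟨c, d, hcd⟩ := h.exists_divg_shapeField_eq hx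
  have h1 : divg φ (fun j y => projN φ y (grad φ (meanCurv φ) j y)) x
      = divg φ (shapeField φ) x := by
    rw [h.divg_congr hx (fun j y hy => h.projN_grad_meanCurv hy j),
      h.divg_add hx (h.contDiffOn_grad h.contDiffOn_meanCurv) h.contDiffOn_shapeField]
    change lap φ (meanCurv φ) x + _ = _
    rw [hC, zero_add]
  rw [lapPerp, h1]
  exact projN_eq_of_inner_eq_zero hcd
    (h.inner_sum_smul_sff_pd hx (fun j k => inner ℝ (meanCurv φ x) (sffUp φ j k x)) 0)
    (h.inner_sum_smul_sff_pd hx (fun j k => inner ℝ (meanCurv φ x) (sffUp φ j k x)) 1)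

theorem sum_sffMixed (h : IsImmersedOn φ U) (hx : x ∈ U) (v : Amb m) :
    ∑ i, ∑ j, inner ℝ v (sffMixed φ i j x) • sffMixed φ j i x
      = ∑ j, ∑ k, inner ℝ v (sffUp φ j k x) • sff φ j k x := by
  simp only [sffMixed, sffUp, Fin.sum_univ_two, inner_add_right, inner_smul_right,
    h.sff_comm hx 1 0, invMetric_comm φ x 1 0]
  module

/-- Under Chen's equation `Δ_⊥ H` equals the quadratic term already present in `W`, hence the factor
two. -/
theorem willmore_eq (h : IsImmersedOn φ U) (hx : x ∈ U) (hC : lap φ (meanCurv φ) x = 0) :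
    willmore φ x = (2 : ℝ) • ∑ j, ∑ k, inner ℝ (meanCurv φ x) (sffUp φ j k x) • sff φ j k x
      - (2 * ‖meanCurv φ x‖ ^ 2) • meanCurv φ x := by
  rw [willmore, h.lapPerp_meanCurv hx hC, h.sum_sffMixed hx, two_smul]

theorem inner_willmore_pd (h : IsImmersedOn φ U) (hx : x ∈ U) (hC : lap φ (meanCurv φ) x = 0)
    (l : Fin 2) : inner ℝ (willmore φ x) (pd l φ x) = (0 : ℝ) := by
  rw [h.willmore_eq hx hC, inner_sub_left, real_inner_smul_left, real_inner_smul_left,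
    h.inner_sum_smul_sff_pd hx (fun j k => inner ℝ (meanCurv φ x) (sffUp φ j k x)),
    h.inner_meanCurv_pd hx]
  simp

theorem sum_invMetric_mul_inner_sff (h : IsImmersedOn φ U) (hx : x ∈ U) :
    invMetric φ x 0 0 * inner ℝ (meanCurv φ x) (sff φ 0 0 x)
      + 2 * invMetric φ x 0 1 * inner ℝ (meanCurv φ x) (sff φ 0 1 x)
      + invMetric φ x 1 1 * inner ℝ (meanCurv φ x) (sff φ 1 1 x) = 2 * ‖meanCurv φ x‖ ^ 2 := by
  have h1 : (2 : ℝ) • meanCurv φ x = invMetric φ x 0 0 • sff φ 0 0 x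
      + (2 * invMetric φ x 0 1) • sff φ 0 1 x + invMetric φ x 1 1 • sff φ 1 1 x := by
    simp only [meanCurv, Fin.sum_univ_two, h.sff_comm hx 1 0, invMetric_comm φ x 1 0]
    module
  have h2 : inner ℝ (meanCurv φ x) ((2 : ℝ) • meanCurv φ x) = 2 * ‖meanCurv φ x‖ ^ 2 := by
    rw [inner_smul_right, real_inner_self_eq_norm_sq]
  rw [← h2, h1]
  simp only [inner_add_right, inner_smul_right]

theorem inner_grad_pd_comm (f g : Plane → Amb m) (x : Plane) :
    inner ℝ (grad φ f 0 x) (pd 0 g x) + inner ℝ (grad φ f 1 x) (pd 1 g x)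
      = (inner ℝ (grad φ g 0 x) (pd 0 f x) + inner ℝ (grad φ g 1 x) (pd 1 f x) : ℝ) := by
  simp only [grad, Fin.sum_univ_two, inner_add_left, real_inner_smul_left,
    invMetric_comm φ x 1 0, real_inner_comm (pd 0 f x) (pd _ g x),
    real_inner_comm (pd 1 f x) (pd _ g x)]
  ring

end IsImmersedOn

/-! ### The tangential part of the divergence, and the side equations -/

namespace IsImmersedOn

variable {m : ℕ} {φ : Plane → Amb m} {U : Set Plane} {x : Plane}

/-- Differentiating `Δφ = 2H` in the direction `∂ₗ`, normal part along `H`. -/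
theorem inner_lap_pd_meanCurv (h : IsImmersedOn φ U) (hx : x ∈ U) (l : Fin 2) :
    sqrtG φ x * inner ℝ (meanCurv φ x) (lap φ (pd l φ) x)
      + (pd l (densMetric φ 0 0) x * inner ℝ (meanCurv φ x) (sff φ 0 0 x)
        + 2 * pd l (densMetric φ 0 1) x * inner ℝ (meanCurv φ x) (sff φ 0 1 x)
        + pd l (densMetric φ 1 1) x * inner ℝ (meanCurv φ x) (sff φ 1 1 x))
      = 2 * (pd l (sqrtG φ) x * ‖meanCurv φ x‖ ^ 2)
        + 2 * (sqrtG φ x * inner ℝ (meanCurv φ x) (pd l (meanCurv φ) x)) := by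
  have hU := h.isOpen
  -- `P` is `|g|^{1/2} ∇ʲφ`. In `∂ₗP = R + Q` the derivative falls on the metric density in `R` and
  -- on `φ` in `Q`. The divergence of `Q` is `|g|^{1/2} Δ(∂ₗφ)`, and pairing that of `R` with the
  -- normal vector `H` leaves only terms in `H · hⱼₖ`.
  let P (j : Fin 2) (y : Plane) : Amb m :=
    densMetric φ j 0 y • pd 0 φ y + densMetric φ j 1 y • pd 1 φ y
  let Q (j : Fin 2) (y : Plane) : Amb m :=
    densMetric φ j 0 y • pd 0 (pd l φ) y + densMetric φ j 1 y • pd 1 (pd l φ) y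
  let R (j : Fin 2) (y : Plane) : Amb m :=
    pd l (densMetric φ j 0) y • pd 0 φ y + pd l (densMetric φ j 1) y • pd 1 φ y
  have hD (j k : Fin 2) := h.contDiffOn_densMetric j k
  have hP (j : Fin 2) : ContDiffOn ℝ ∞ (P j) U :=
    ((hD j 0).smul (h.contDiffOn_pd 0)).add ((hD j 1).smul (h.contDiffOn_pd 1))
  have hQ (j : Fin 2) : ContDiffOn ℝ ∞ (Q j) U :=
    ((hD j 0).smul (ContDiffOn.pd 0 hU (h.contDiffOn_pd l))).add
      ((hD j 1).smul (ContDiffOn.pd 1 hU (h.contDiffOn_pd l)))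
  have hDl (j k : Fin 2) : ContDiffOn ℝ ∞ (pd l (densMetric φ j k)) U := ContDiffOn.pd l hU (hD j k)
  have hR (j : Fin 2) : ContDiffOn ℝ ∞ (R j) U :=
    ((hDl j 0).smul (h.contDiffOn_pd 0)).add ((hDl j 1).smul (h.contDiffOn_pd 1))
  have hlP (j : Fin 2) : ∀ y ∈ U, pd l (P j) y = R j y + Q j y := fun y hy => by
    rw [h.pd_dens_smul_pd hy h.contDiffOn, h.pd_pd_comm hy l 0, h.pd_pd_comm hy l 1]
    simp only [R, Q]
    module
  have hd {f : Plane → Amb m} (hf : ContDiffOn ℝ ∞ f U) := h.differentiableAt hf hx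
  have e1 : pd l (fun y => pd 0 (P 0) y + pd 1 (P 1) y) x
      = (pd 0 (R 0) x + pd 0 (Q 0) x) + (pd 1 (R 1) x + pd 1 (Q 1) x) := by
    rw [pd_add l (hd (ContDiffOn.pd 0 hU (hP 0))) (hd (ContDiffOn.pd 1 hU (hP 1))),
      pd_comm l 0 hU (hP 0) hx, pd_comm l 1 hU (hP 1) hx, pd_congr 0 hU (hlP 0) hx,
      pd_congr 1 hU (hlP 1) hx, pd_add 0 (hd (hR 0)) (hd (hQ 0)),
      pd_add 1 (hd (hR 1)) (hd (hQ 1))]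
  have hs := h.differentiableAt h.contDiffOn_sqrtG hx
  have e2 : pd l (fun y => pd 0 (P 0) y + pd 1 (P 1) y) x
      = (2 : ℝ) • (pd l (sqrtG φ) x • meanCurv φ x + sqrtG φ x • pd l (meanCurv φ) x) := by
    rw [← pd_smul l hs (hd h.contDiffOn_meanCurv),
      ← pd_const_smul l 2 (f := fun y => sqrtG φ y • meanCurv φ y)
        (hd (h.contDiffOn_sqrtG.smul h.contDiffOn_meanCurv))]
    refine pd_congr l hU (fun y hy => ?_) hx
    rw [← h.sqrtG_smul_lap hy φ, h.lap_self hy]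
    exact smul_comm _ _ _
  have e3 : pd 0 (Q 0) x + pd 1 (Q 1) x = sqrtG φ x • lap φ (pd l φ) x :=
    (h.sqrtG_smul_lap hx (pd l φ)).symm
  have e4 (j : Fin 2) : inner ℝ (meanCurv φ x) (pd j (R j) x)
      = pd l (densMetric φ j 0) x * inner ℝ (meanCurv φ x) (sff φ j 0 x)
        + pd l (densMetric φ j 1) x * inner ℝ (meanCurv φ x) (sff φ j 1 x) := by
    have hDd (k : Fin 2) := h.differentiableAt (hDl j k) hx
    rw [pd_add j ((hDd 0).fun_smul (hd (h.contDiffOn_pd 0)))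
      ((hDd 1).fun_smul (hd (h.contDiffOn_pd 1))), pd_smul j (hDd 0) (hd (h.contDiffOn_pd 0)),
      pd_smul j (hDd 1) (hd (h.contDiffOn_pd 1))]
    simp only [inner_add_right, inner_smul_right, h.inner_meanCurv_pd hx,
      h.inner_meanCurv_pd_pd hx]
    ring
  have e5 := congrArg (fun v => (inner ℝ (meanCurv φ x) v : ℝ)) (e1.symm.trans e2)
  have e6 := congrArg (fun v => (inner ℝ (meanCurv φ x) v : ℝ)) e3
  simp only [inner_add_right, inner_smul_right, e4, real_inner_self_eq_norm_sq] at e5 e6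
  rw [h.sff_comm hx 1 0, show densMetric φ 1 0 = densMetric φ 0 1 from
    funext (densMetric_comm φ 1 0)] at e5
  linear_combination e5 - e6

/-- The derivative of the inverse metric density, contracted with `H · h_{jk}`. -/
theorem sum_pd_densMetric_mul_inner_sff (h : IsImmersedOn φ U) (hx : x ∈ U) (l : Fin 2) :
    pd l (densMetric φ 0 0) x * inner ℝ (meanCurv φ x) (sff φ 0 0 x)
        + 2 * pd l (densMetric φ 0 1) x * inner ℝ (meanCurv φ x) (sff φ 0 1 x)
        + pd l (densMetric φ 1 1) x * inner ℝ (meanCurv φ x) (sff φ 1 1 x)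
      = 2 * (pd l (sqrtG φ) x * ‖meanCurv φ x‖ ^ 2)
        - 2 * (sqrtG φ x * (inner ℝ (shapeField φ 0 x) (pd 0 (pd l φ) x)
          + inner ℝ (shapeField φ 1 x) (pd 1 (pd l φ) x))) := by
  have hs := (h.sqrtG_pos hx).ne'
  have hH := h.sum_invMetric_mul_inner_sff hx
  obtain ⟨a1, a2, a3⟩ := h.pd_sqrtG_mul_densMetric hx l
  have hD (j k : Fin 2) := h.differentiableAt (h.contDiffOn_densMetric j k) hx
  -- In dimension two the density `|g|^{1/2} g^{jk}` has determinant one.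
  have hdet : ∀ y ∈ U, densMetric φ 0 0 y * densMetric φ 1 1 y
      - densMetric φ 0 1 y * densMetric φ 0 1 y = 1 := fun y hy => by
    obtain ⟨d1, d2, -, d4⟩ := h.densMetric_eq hy
    have hsy := (h.sqrtG_pos hy).ne'
    have hss := h.sqrtG_mul_self hy
    rw [d1, d2, d4]
    field_simp
    linear_combination -hss
  have hdet' := pd_congr l h.isOpen hdet hx
  rw [pd_const, pd_sub l ((hD 0 0).fun_mul (hD 1 1)) ((hD 0 1).fun_mul (hD 0 1)),
    pd_mul l (hD 0 0) (hD 1 1), pd_mul l (hD 0 1) (hD 0 1)] at hdet'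
  replace hdet := hdet x hx
  have hsym : ∀ i j : Fin 2, inner ℝ (pd i φ x) (pd l (pd j φ) x)
      = (inner ℝ (pd l (pd j φ) x) (pd i φ x) : ℝ) := fun i j => real_inner_comm _ _
  rw [h.pd_metric hx] at a1 a2 a3
  simp only [hsym] at a1 a2 a3
  simp only [shapeField, sffUp, Fin.sum_univ_two, h.pd_pd_comm hx _ l, inner_add_left,
    inner_add_right, real_inner_smul_left, inner_smul_right, hsym, h.sff_comm hx 1 0,
    invMetric_comm φ x 1 0]
  simp only [densMetric] at a1 a2 a3 hdet hdet'
  set i00 := invMetric φ x 0 0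
  set i01 := invMetric φ x 0 1
  set i11 := invMetric φ x 1 1
  set A00 : ℝ := inner ℝ (meanCurv φ x) (sff φ 0 0 x)
  set A01 : ℝ := inner ℝ (meanCurv φ x) (sff φ 0 1 x)
  set A11 : ℝ := inner ℝ (meanCurv φ x) (sff φ 1 1 x)
  set s := sqrtG φ x
  set sl := pd l (sqrtG φ) x
  -- This is `∂g⁻¹ = -g⁻¹ (∂g) g⁻¹` contracted with `H · hⱼₖ`: up to the factor `s`, signs and the 2
  -- of the off-diagonal entry, the relations `a1`, `a2`, `a3` are weighted by `H · h¹¹`, `H · h⁰¹`,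
  -- `H · h⁰⁰`.
  linear_combination sl * hH
    - s * (i00 * i00 * A00 + 2 * i00 * i01 * A01 + i01 * i01 * A11) * a3
    + 2 * s * (i00 * i01 * A00 + (i00 * i11 + i01 * i01) * A01 + i01 * i11 * A11) * a2
    - s * (i01 * i01 * A00 + 2 * i01 * i11 * A01 + i11 * i11 * A11) * a1
    + sl * (i00 * A00 + 2 * i01 * A01 + i11 * A11) * hdet
    - (pd l (densMetric φ 0 0) x * A00 + 2 * pd l (densMetric φ 0 1) x * A01
      + pd l (densMetric φ 1 1) x * A11) * hdet
    + s * (i00 * A00 + 2 * i01 * A01 + i11 * A11) * hdet'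

/-- The tangential part of the divergence of the shape field, by Codazzi and Chen's equations. -/
theorem inner_divg_shapeField_pd (h : IsImmersedOn φ U) (hx : x ∈ U)
    (hC : lap φ (meanCurv φ) x = 0) (l : Fin 2) :
    inner ℝ (divg φ (shapeField φ) x) (pd l φ x)
      = inner ℝ (meanCurv φ x) (pd l (meanCurv φ) x) := by
  have hH := h.contDiffOn_meanCurv
  have hgH := h.contDiffOn_grad hH
  have hgl := h.contDiffOn_grad (h.contDiffOn_pd l)
  have hC' : divg φ (grad φ (meanCurv φ)) x = 0 := hC
  -- Let `D = ∇ⱼ(∇ʲH · ∂ₗφ)`. Chen's equation gives `D = ∇ʲH · ∂ⱼ∂ₗφ`, while `∇ʲH · ∂ₗφ = -H ·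
  -- ∇ʲ∂ₗφ` gives `-D = H · Δ∂ₗφ + ∇ʲ∂ₗφ · ∂ⱼH`. The cross terms coincide, so `-2D = H · Δ∂ₗφ`. As
  -- `Aʲ · ∂ₗφ = -∇ʲH · ∂ₗφ`, it follows that `(∇ⱼAʲ) · ∂ₗφ = ½ H · Δ∂ₗφ - Aʲ · ∂ⱼ∂ₗφ`, which the
  -- differentiated equation `Δφ = 2H` evaluates as `H · ∂ₗH`.
  have e1 := h.divg_inner hx h.contDiffOn_shapeField (h.contDiffOn_pd l)
  have e2 := h.divg_inner hx hgH (h.contDiffOn_pd l)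
  have e3 := h.divg_inner hx hgl hH
  have e4 : divg φ (fun j y => (inner ℝ (shapeField φ j y) (pd l φ y) : ℝ)) x
      = -divg φ (fun j y => (inner ℝ (grad φ (meanCurv φ) j y) (pd l φ y) : ℝ)) x := by
    rw [← neg_one_smul ℝ, ← h.divg_const_smul hx (-1) fun j => (hgH j).inner ℝ (h.contDiffOn_pd l)]
    exact h.divg_congr hx fun j y hy => by rw [h.inner_shapeField_pd hy]; simp
  have e5 : divg φ (fun j y => (inner ℝ (grad φ (meanCurv φ) j y) (pd l φ y) : ℝ)) x
      = -divg φ (fun j y => (inner ℝ (grad φ (pd l φ) j y) (meanCurv φ y) : ℝ)) x := by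
    rw [← neg_one_smul ℝ, ← h.divg_const_smul hx (-1) fun j => (hgl j).inner ℝ hH]
    refine h.divg_congr hx fun j y hy => ?_
    rw [h.inner_grad_meanCurv_pd hy]
    simp only [grad, Fin.sum_univ_two, real_inner_comm (meanCurv φ y), inner_add_right,
      inner_smul_right, h.inner_meanCurv_pd_pd hy, smul_eq_mul]
    ring
  have e6 := inner_grad_pd_comm (meanCurv φ) (pd l φ) (φ := φ) x
  have e7 := h.inner_lap_pd_meanCurv hx l
  rw [h.sum_pd_densMetric_mul_inner_sff hx l] at e7
  rw [hC', inner_zero_left, zero_add] at e2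
  change _ = inner ℝ (lap φ (pd l φ) x) _ + _ at e3
  rw [real_inner_comm] at e3
  have hs := (h.sqrtG_pos hx).ne'
  refine mul_left_cancel₀ hs ?_
  linear_combination e7 / 2 - sqrtG φ x * e1 + sqrtG φ x * e4 - sqrtG φ x / 2 * e2
    + sqrtG φ x / 2 * e3 - sqrtG φ x / 2 * e5 - sqrtG φ x / 2 * e6

theorem contDiffOn_normSq_meanCurv (h : IsImmersedOn φ U) :
    ContDiffOn ℝ ∞ (fun y => ‖meanCurv φ y‖ ^ 2) U :=
  h.contDiffOn_meanCurv.norm_sq ℝ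

/-- `∇ⱼFʲ = -W`. -/
theorem divg_chenField (h : IsImmersedOn φ U) (hx : x ∈ U) (hC : lap φ (meanCurv φ) x = 0) :
    divg φ (chenField φ) x = -willmore φ x := by
  have hH := h.contDiffOn_meanCurv
  have hgφ := h.contDiffOn_grad h.contDiffOn
  have hN := h.contDiffOn_normSq_meanCurv
  have e1 : divg φ (chenField φ) x
      = divg φ (fun j y => ‖meanCurv φ y‖ ^ 2 • grad φ φ j y) x
        + (-2 : ℝ) • divg φ (shapeField φ) x := by
    rw [← h.divg_const_smul hx (-2) h.contDiffOn_shapeField,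
      ← h.divg_add hx (F := fun j y => ‖meanCurv φ y‖ ^ 2 • grad φ φ j y)
        (G := fun j y => (-2 : ℝ) • shapeField φ j y) (fun j => hN.smul (hgφ j))
        (fun j => (h.contDiffOn_shapeField j).const_smul (-2 : ℝ))]
    refine h.divg_congr hx fun j y _ => ?_
    rw [neg_smul, ← sub_eq_add_neg]
    rfl
  have hpN (j : Fin 2) : pd j (fun y => ‖meanCurv φ y‖ ^ 2) x
      = 2 * inner ℝ (meanCurv φ x) (pd j (meanCurv φ) x) := by
    have hd := h.differentiableAt hH hx
    simp only [← real_inner_self_eq_norm_sq]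
    rw [pd_inner j hd hd, real_inner_comm]
    ring
  have hlap : divg φ (grad φ φ) x = (2 : ℝ) • meanCurv φ x := h.lap_self hx
  rw [h.divg_smul hx hN hgφ, hpN, hpN, hlap] at e1
  obtain ⟨c, d, hcd⟩ := h.exists_divg_shapeField_eq hx
  -- Both sides vanish: the gradient of `|H|²` contributes `2 H · ∂ₗH`, and `-2 ∇ⱼAʲ` cancels it.
  have htan (l : Fin 2) : inner ℝ (divg φ (chenField φ) x) (pd l φ x)
      = inner ℝ (-willmore φ x) (pd l φ x) := by
    rw [inner_neg_left, h.inner_willmore_pd hx hC, e1]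
    have h0 := h.sum_metric_mul_invMetric hx l 0
    have h1 := h.sum_metric_mul_invMetric hx l 1
    simp only [inner_add_left, real_inner_smul_left, h.inner_divg_shapeField_pd hx hC,
      h.inner_meanCurv_pd hx, grad, Fin.sum_univ_two, ← metric_apply]
    simp only [metric_comm φ x _ l, invMetric_comm φ x 1 0] at h0 h1 ⊢
    fin_cases l
    · simp at h0 h1 ⊢
      linear_combination 2 * inner ℝ (meanCurv φ x) (pd 0 (meanCurv φ) x) * h0
        + 2 * inner ℝ (meanCurv φ x) (pd 1 (meanCurv φ) x) * h1
    · simp at h0 h1 ⊢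
      linear_combination 2 * inner ℝ (meanCurv φ x) (pd 0 (meanCurv φ) x) * h0
        + 2 * inner ℝ (meanCurv φ x) (pd 1 (meanCurv φ) x) * h1
  refine eq_of_sub_mem_span_of_inner_eq (a := pd 0 φ x) (b := pd 1 φ x)
    (c := 2 * inner ℝ (meanCurv φ x) (pd 0 (meanCurv φ) x) * invMetric φ x 0 0
      + 2 * inner ℝ (meanCurv φ x) (pd 1 (meanCurv φ) x) * invMetric φ x 1 0 - 2 * c)
    (d := 2 * inner ℝ (meanCurv φ x) (pd 0 (meanCurv φ) x) * invMetric φ x 0 1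
      + 2 * inner ℝ (meanCurv φ x) (pd 1 (meanCurv φ) x) * invMetric φ x 1 1 - 2 * d)
    ?_ (htan 0) (htan 1)
  rw [e1, hcd, h.willmore_eq hx hC]
  simp only [grad, Fin.sum_univ_two]
  module

/-- `H` is normal, so the derivative falling on `φ` contributes nothing. -/
theorem grad_inner_meanCurv (h : IsImmersedOn φ U) (hx : x ∈ U) (j : Fin 2) :
    grad φ (fun y => (inner ℝ (φ y) (meanCurv φ y) : ℝ)) j x
      = inner ℝ (grad φ (meanCurv φ) j x) (φ x) := by
  have hp (k : Fin 2) := pd_inner k (h.differentiableAt h.contDiffOn hx)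
    (h.differentiableAt h.contDiffOn_meanCurv hx)
  simp only [grad, hp, Fin.sum_univ_two, inner_add_left, real_inner_smul_left,
    real_inner_comm (meanCurv φ x), h.inner_meanCurv_pd hx, zero_add, smul_eq_mul]
  rw [real_inner_comm (φ x), real_inner_comm (φ x)]

/-- `Δ(φ · H) = -2 |H|²` under Chen's equation. -/
theorem lap_inner_meanCurv (h : IsImmersedOn φ U) (hx : x ∈ U)
    (hC : lap φ (meanCurv φ) x = 0) :
    lap φ (fun y => (inner ℝ (φ y) (meanCurv φ y) : ℝ)) x = -2 * ‖meanCurv φ x‖ ^ 2 := by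
  have hC' : divg φ (grad φ (meanCurv φ)) x = 0 := hC
  rw [lap, h.divg_congr hx (fun j y hy => h.grad_inner_meanCurv hy j),
    h.divg_inner hx (h.contDiffOn_grad h.contDiffOn_meanCurv) h.contDiffOn, hC',
    h.inner_grad_meanCurv_pd hx, h.inner_grad_meanCurv_pd hx, h.sff_comm hx 1 0,
    invMetric_comm φ x 1 0, inner_zero_left]
  linear_combination -h.sum_invMetric_mul_inner_sff hx

/-- The trace of `|H|² ∇ʲφ` is `2|H|²` and that of `-2Aʲ` is `-4|H|²`. -/
theorem sum_inner_chenField_pd (h : IsImmersedOn φ U) (hx : x ∈ U) :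
    ∑ j, inner ℝ (chenField φ j x) (pd j φ x) = -2 * ‖meanCurv φ x‖ ^ 2 := by
  have h0 := h.sum_metric_mul_invMetric hx 0 0
  have h1 := h.sum_metric_mul_invMetric hx 1 1
  have hF (j : Fin 2) : inner ℝ (chenField φ j x) (pd j φ x)
      = ‖meanCurv φ x‖ ^ 2 * inner ℝ (grad φ φ j x) (pd j φ x)
        - 2 * inner ℝ (shapeField φ j x) (pd j φ x) := by
    rw [← real_inner_smul_left, ← real_inner_smul_left, ← inner_sub_left]
    rfl
  have hA := h.sum_invMetric_mul_inner_sff hx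
  rw [Fin.sum_univ_two, hF, hF, h.inner_shapeField_pd hx, h.inner_shapeField_pd hx,
    h.inner_grad_meanCurv_pd hx, h.inner_grad_meanCurv_pd hx, h.sff_comm hx 1 0]
  simp only [grad, Fin.sum_univ_two, inner_add_left, real_inner_smul_left, ← metric_apply]
  simp only [metric_comm φ x 1 0, invMetric_comm φ x 1 0] at h0 h1 ⊢
  simp at h0 h1
  linear_combination ‖meanCurv φ x‖ ^ 2 * (h0 + h1) - 2 * hA

/-- The coefficients of `Fʲ` in `∂ₖφ` are symmetric in `j` and `k`, while `∂ₖφ ∧ ∂ⱼφ` is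
antisymmetric. -/
theorem sum_wedge_chenField_pd (h : IsImmersedOn φ U) (hx : x ∈ U) :
    ∑ j, wedge (chenField φ j x) (pd j φ x) = 0 := by
  have hsym : sffUp φ 1 0 x = sffUp φ 0 1 x := by
    simp only [sffUp, Fin.sum_univ_two, h.sff_comm hx 1 0]
    module
  have hF (j : Fin 2) : chenField φ j x
      = (‖meanCurv φ x‖ ^ 2 * invMetric φ x j 0
          - 2 * inner ℝ (meanCurv φ x) (sffUp φ j 0 x)) • pd 0 φ x
        + (‖meanCurv φ x‖ ^ 2 * invMetric φ x j 1
          - 2 * inner ℝ (meanCurv φ x) (sffUp φ j 1 x)) • pd 1 φ x := by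
    simp only [chenField, grad, Fin.sum_univ_two]
    module
  rw [Fin.sum_univ_two, hF, hF, hsym, invMetric_comm φ x 1 0]
  simp only [wedge_add_left, wedge_smul_left, wedge_self, wedge_swap (pd 0 φ x) (pd 1 φ x),
    smul_zero, smul_neg]
  abel

theorem sideSystem (h : IsImmersedOn φ U) (hC : ∀ x ∈ U, lap φ (meanCurv φ) x = 0) :
    SideSystem φ (chenField φ) (fun _ => 0)
      (fun x => (inner ℝ (φ x) (meanCurv φ x) : ℝ)) U := by
  refine fun x hx => ⟨h.divg_chenField hx (hC x hx), ?_, ?_⟩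
  · rw [h.sum_wedge_chenField_pd hx]
    refine h.eq_of_sqrtG_smul_eq hx ?_
    rw [h.sqrtG_smul_lap hx]
    simp [pd_const]
  · rw [h.lap_inner_meanCurv hx (hC x hx), h.sum_inner_chenField_pd hx]

end IsImmersedOn

/-! ### Pointwise algebra of the system: `a, b` are `∂₀φ, ∂₁φ`, `s` is `|g|^{1/2}`, `i00, i01, i11`
are `g^{jk}`, `Y0, Y1` are `∇ʲY` -/

section Algebra

variable {m : ℕ} {a b L H h00 h01 h11 : Amb m} {s i00 i01 i11 Y0 Y1 : ℝ}

theorem wedge_sub_left (u v w : Amb m) : wedge (u - v) w = wedge u w - wedge v w := by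
  rw [sub_eq_add_neg, wedge_add_left, ← neg_one_smul ℝ v, wedge_smul_left]
  module

theorem interiorMul_sub_left (α β : TwoVec m) (v : Amb m) :
    interiorMul (α - β) v = interiorMul α v - interiorMul β v := by
  rw [sub_eq_add_neg, interiorMul_add_left, ← neg_one_smul ℝ β, interiorMul_smul_left]
  module

theorem contract_sub_right (α η θ : TwoVec m) :
    contract α (η - θ) = contract α η - contract α θ := map_sub _ _ _

/-- The first equation of the system, as an identity of linear algebra. -/
theorem inner_gaussMap_potential (hs : s ≠ 0)
    (h00a : inner ℝ h00 a = (0 : ℝ)) (h00b : inner ℝ h00 b = (0 : ℝ))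
    (h01a : inner ℝ h01 a = (0 : ℝ)) (h01b : inner ℝ h01 b = (0 : ℝ))
    (h11a : inner ℝ h11 a = (0 : ℝ)) (h11b : inner ℝ h11 b = (0 : ℝ))
    (hHa : inner ℝ H a = (0 : ℝ)) (hHb : inner ℝ H b = (0 : ℝ))
    (haa : inner ℝ a a = s * s * i11) (hab : inner ℝ a b = -(s * s * i01))
    (hbb : inner ℝ b b = s * s * i00)
    (hH : (2 : ℝ) • H = i00 • h00 + (2 * i01) • h01 + i11 • h11) :
    inner ℝ (s⁻¹ • (wedge h00 b + wedge a h01))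
        (wedge L b + s • wedge H (i00 • a + i01 • b))
      - inner ℝ (s⁻¹ • (wedge h01 b + wedge a h11))
        (wedge L a - s • wedge H (i01 • a + i11 • b))
      = 2 * s * inner ℝ L H := by
  have hsm (c : ℝ) (α β : TwoVec m) : inner ℝ (c • α) β = c * inner ℝ α β := by
    rw [real_inner_comm, inner_twoVec_smul, real_inner_comm]
  have hLH : 2 * inner ℝ L H
      = i00 * inner ℝ L h00 + 2 * i01 * inner ℝ L h01 + i11 * inner ℝ L h11 := by
    have := congrArg (fun v => (inner ℝ L v : ℝ)) hH
    simpa only [inner_add_right, inner_smul_right] using this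
  have hba : inner ℝ b a = -(s * s * i01) := by rw [real_inner_comm, hab]
  have c3 : inner ℝ a H = (0 : ℝ) := by rw [real_inner_comm, hHa]
  have c4 : inner ℝ b H = (0 : ℝ) := by rw [real_inner_comm, hHb]
  simp only [hsm, inner_twoVec_smul, inner_add_left, inner_add_right, inner_sub_right,
    wedge_add_right, wedge_smul_right, inner_wedge, h00a, h00b, h01a, h01b, h11a, h11b,
    haa, hab, hba, hbb, c3, c4, real_inner_comm L]
  field_simp
  linear_combination -s * s * hLH

/-- The third equation of the system, as an identity of linear algebra. -/
theorem interiorMul_potential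
    (hHa : inner ℝ H a = (0 : ℝ)) (hHb : inner ℝ H b = (0 : ℝ))
    (haa : inner ℝ a a = s * s * i11) (hab : inner ℝ a b = -(s * s * i01))
    (hbb : inner ℝ b b = s * s * i00) (hdet : s * s * (i00 * i11 - i01 * i01) = 1) :
    (2 * s) • H = (inner ℝ L a - s * Y1) • b - (inner ℝ L b + s * Y0) • a
      + (interiorMul (wedge L a - s • wedge H (i01 • a + i11 • b)) b
        - interiorMul (wedge L b + s • wedge H (i00 • a + i01 • b)) a)
      + s • (Y0 • a + Y1 • b) := by
  have hba : inner ℝ b a = -(s * s * i01) := by rw [real_inner_comm, hab]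
  simp only [interiorMul_sub_left, interiorMul_add_left, interiorMul_smul_left, wedge_add_right,
    wedge_smul_right, interiorMul_wedge, hHa, hHb, haa, hab, hba, hbb]
  match_scalars
  -- The coefficient of `H` is `s` times the trace `∇ʲφ · ∂ⱼφ = 2`.
  · linear_combination (-2 * s) * hdet
  all_goals ring

/-- The second equation of the system, as an identity of linear algebra. -/
theorem contract_gaussMap_potential (hs : s ≠ 0)
    (h00a : inner ℝ h00 a = (0 : ℝ)) (h00b : inner ℝ h00 b = (0 : ℝ))
    (h01a : inner ℝ h01 a = (0 : ℝ)) (h01b : inner ℝ h01 b = (0 : ℝ))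
    (h11a : inner ℝ h11 a = (0 : ℝ)) (h11b : inner ℝ h11 b = (0 : ℝ))
    (hHa : inner ℝ H a = (0 : ℝ)) (hHb : inner ℝ H b = (0 : ℝ))
    (haa : inner ℝ a a = s * s * i11) (hab : inner ℝ a b = -(s * s * i01))
    (hbb : inner ℝ b b = s * s * i00)
    (hH : (2 : ℝ) • H = i00 • h00 + (2 * i01) • h01 + i11 • h11) {y : ℝ}
    (hy : y = -(i00 * inner ℝ H h00 + 2 * i01 * inner ℝ H h01 + i11 * inner ℝ H h11)) :
    s • wedge L ((2 : ℝ) • H)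
      = -((inner ℝ L b + s * Y0) • (s⁻¹ • (wedge h00 b + wedge a h01))
          + contract (s⁻¹ • (wedge h00 b + wedge a h01))
            (wedge L b + s • wedge H (i00 • a + i01 • b))
          - ((inner ℝ L a - s * Y1) • (s⁻¹ • (wedge h01 b + wedge a h11))
          + contract (s⁻¹ • (wedge h01 b + wedge a h11))
            (wedge L a - s • wedge H (i01 • a + i11 • b))))
        + s • (y • (s⁻¹ • wedge a b) + (Y0 • (s⁻¹ • (wedge h00 b + wedge a h01))
          + Y1 • (s⁻¹ • (wedge h01 b + wedge a h11)))) := by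
  have hba : inner ℝ b a = -(s * s * i01) := by rw [real_inner_comm, hab]
  have c1 : inner ℝ a H = (0 : ℝ) := by rw [real_inner_comm, hHa]
  have c2 : inner ℝ b H = (0 : ℝ) := by rw [real_inner_comm, hHb]
  rw [hH, hy]
  simp only [contract_add_right, contract_sub_right, contract_smul_right, contract_wedge,
    interiorMul_add_left, interiorMul_smul_left, interiorMul_wedge,
    wedge_add_right, wedge_smul_right, wedge_add_left, wedge_sub_left, wedge_smul_left,
    h00a, h00b, h01a, h01b, h11a, h11b, haa, hab, hba, hbb, c1, c2, wedge_self,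
    real_inner_comm H, real_inner_comm L]
  -- Each wedge monomial gets a fixed orientation so that coefficients can be compared. Those of `a
  -- ∧ b` carrying `H · hⱼₖ` cancel against `y`, the value of `ΔY`.
  simp only [wedge_swap h00 L, wedge_swap h01 L, wedge_swap h11 L, wedge_swap h01 a,
    wedge_swap h11 a, wedge_swap a b]
  match_scalars <;> field_simp
  all_goals ring

end Algebra
-- Rotated gradients and potentials
theorem sum_eps_zero {V : Type*} [AddCommGroup V] [Module ℝ V] (v : Fin 2 → V) :
    ∑ k, eps k 0 • v k = -v 1 := by
  simp [eps]

theorem sum_eps_one {V : Type*} [AddCommGroup V] [Module ℝ V] (v : Fin 2 → V) :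
    ∑ k, eps k 1 • v k = v 0 := by
  simp [eps]

theorem sum_sum_eps {V : Type*} [AddCommGroup V] [Module ℝ V] (v : Fin 2 → Fin 2 → V) :
    ∑ j, ∑ k, eps j k • v j k = v 0 1 - v 1 0 := by
  simp [eps, sub_eq_add_neg]

namespace IsImmersedOn

variable {V : Type*} [NormedAddCommGroup V] [NormedSpace ℝ V] {m : ℕ} {φ : Plane → Amb m}
  {U : Set Plane} {x : Plane}

theorem contDiffOn_sqrtG_inv (h : IsImmersedOn φ U) :
    ContDiffOn ℝ ∞ (fun y => (sqrtG φ y)⁻¹) U :=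
  h.contDiffOn_sqrtG.inv fun _ hx => (h.sqrtG_pos hx).ne'

theorem divg_wedge (h : IsImmersedOn φ U) (hx : x ∈ U) {F : Fin 2 → Plane → Amb m}
    {u : Plane → Amb m} (hF : ∀ j, ContDiffOn ℝ ∞ (F j) U) (hu : ContDiffOn ℝ ∞ u U) :
    divg φ (fun j y => wedge (u y) (F j y)) x
      = wedge (pd 0 u x) (F 0 x) + wedge (pd 1 u x) (F 1 x) + wedge (u x) (divg φ F x) := by
  refine h.eq_of_sqrtG_smul_eq hx ?_
  have hu' := h.differentiableAt hu hx
  rw [smul_add, ← wedge_smul_right, h.divg_expand hx hF,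
    h.divg_expand hx (F := fun j y => wedge (u y) (F j y)) fun j => ContDiffOn.wedge hu (hF j),
    pd_wedge 0 hu' (h.differentiableAt (hF 0) hx), pd_wedge 1 hu' (h.differentiableAt (hF 1) hx)]
  simp only [wedge_add_right, wedge_smul_right]
  module

/-- The divergence of a rotated field. -/
theorem divg_rot (h : IsImmersedOn φ U) (hx : x ∈ U) (B : Fin 2 → Plane → V) :
    divg φ (fun j y => (sqrtG φ y)⁻¹ • ∑ k, eps k j • B k y) x
      = (sqrtG φ x)⁻¹ • (pd 1 (B 0) x - pd 0 (B 1) x) := by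
  refine h.eq_of_sqrtG_smul_eq hx ?_
  rw [h.sqrtG_smul_divg hx, smul_inv_smul₀ (h.sqrtG_pos hx).ne',
    pd_congr 0 h.isOpen (g := fun y => -B 1 y) (fun y hy => by
      rw [smul_inv_smul₀ (h.sqrtG_pos hy).ne', sum_eps_zero fun k => B k y]) hx,
    pd_congr 1 h.isOpen (g := B 0) (fun y hy => by
      rw [smul_inv_smul₀ (h.sqrtG_pos hy).ne', sum_eps_one fun k => B k y]) hx, pd_neg]
  abel

/-- The rotation `|g|^{-1/2} ε^{kj}` is invertible; this turns every decomposition into explicit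
partial derivatives of its potential. -/
theorem eq_rot_iff (h : IsImmersedOn φ U) (hx : x ∈ U) (T v : Fin 2 → V) :
    (∀ j, T j = (sqrtG φ x)⁻¹ • ∑ k, eps k j • v k)
      ↔ v 0 = sqrtG φ x • T 1 ∧ v 1 = -(sqrtG φ x • T 0) := by
  have hs := (h.sqrtG_pos hx).ne'
  rw [Fin.forall_fin_two, sum_eps_zero v, sum_eps_one v]
  refine ⟨fun ⟨h0, h1⟩ => ⟨?_, ?_⟩, fun ⟨h0, h1⟩ => ⟨?_, ?_⟩⟩
  · rw [h1, smul_inv_smul₀ hs]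
  · rw [h0, smul_inv_smul₀ hs, neg_neg]
  · rw [h1, neg_neg, inv_smul_smul₀ hs]
  · rw [h0, inv_smul_smul₀ hs]

/-- Divergence-free fields on simply connected domains are rotated gradients. -/
theorem exists_potential (h : IsImmersedOn φ U) (hsc : IsSimplyConnected U) [CompleteSpace V]
    {T : Fin 2 → Plane → V} (hT : ∀ j, ContDiffOn ℝ ∞ (T j) U)
    (hdiv : ∀ x ∈ U, divg φ T x = 0) :
    ∃ f : Plane → V, ContDiffOn ℝ ∞ f U ∧
      ∀ x ∈ U, ∀ j, T j x = (sqrtG φ x)⁻¹ • ∑ k, eps k j • pd k f x := by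
  -- The 1-form `|g|^{1/2} (T¹ dx⁰ - T⁰ dx¹)` is closed exactly when `T` is divergence-free.
  obtain ⟨f, hf, hpd⟩ := exists_contDiffOn_pd_eq h.isOpen hsc
    (p := fun y => sqrtG φ y • T 1 y) (q := fun y => -(sqrtG φ y • T 0 y))
    (h.contDiffOn_sqrtG.smul (hT 1)) (h.contDiffOn_sqrtG.smul (hT 0)).neg (fun x hx => by
      have h1 := h.sqrtG_smul_divg hx T
      rw [hdiv x hx, smul_zero] at h1
      rw [pd_neg]
      exact (neg_eq_of_add_eq_zero_right h1.symm).symm)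
  exact ⟨f, hf, fun x hx => (h.eq_rot_iff hx (fun j => T j x) fun k => pd k f x).2 (hpd x hx)⟩

theorem sq_sqrtG_mul_det_invMetric (h : IsImmersedOn φ U) (hx : x ∈ U) :
    sqrtG φ x * sqrtG φ x * (invMetric φ x 0 0 * invMetric φ x 1 1
      - invMetric φ x 0 1 * invMetric φ x 0 1) = 1 := by
  have hs := (h.sqrtG_pos hx).ne'
  have hss := h.sqrtG_mul_self hx
  obtain ⟨h1, h2, -, h4⟩ := h.invMetric_eq hx
  rw [h1, h2, h4]
  field_simp
  linear_combination -hss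

theorem metric_eq (h : IsImmersedOn φ U) (hx : x ∈ U) :
    metric φ x 0 0 = sqrtG φ x * sqrtG φ x * invMetric φ x 1 1 ∧
    metric φ x 0 1 = -(sqrtG φ x * sqrtG φ x * invMetric φ x 0 1) ∧
    metric φ x 1 1 = sqrtG φ x * sqrtG φ x * invMetric φ x 0 0 := by
  have hs := (h.sqrtG_pos hx).ne'
  obtain ⟨h1, h2, -, h4⟩ := h.invMetric_eq hx
  rw [h1, h2, h4]
  refine ⟨?_, ?_, ?_⟩ <;> field_simp

/-- The gradient of a function whose differential is `p + ⋆q`. -/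
theorem grad_of_pd_eq (h : IsImmersedOn φ U) (hx : x ∈ U) {f : Plane → V} {p q : Fin 2 → V}
    (h0 : pd 0 f x = p 0 - sqrtG φ x • (invMetric φ x 1 0 • q 0 + invMetric φ x 1 1 • q 1))
    (h1 : pd 1 f x = p 1 + sqrtG φ x • (invMetric φ x 0 0 • q 0 + invMetric φ x 0 1 • q 1))
    (j : Fin 2) :
    grad φ f j x = (invMetric φ x j 0 • p 0 + invMetric φ x j 1 • p 1)
      + (sqrtG φ x)⁻¹ • ∑ k, eps k j • q k := by
  have hs := (h.sqrtG_pos hx).ne'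
  have hdet := h.sq_sqrtG_mul_det_invMetric hx
  rw [grad, Fin.sum_univ_two, h0, h1]
  rw [invMetric_comm φ x 1 0]
  fin_cases j
  · rw [Fin.zero_eta, sum_eps_zero]
    match_scalars
    · ring
    · ring
    · field_simp
      linear_combination -hdet
    · ring
  · rw [Fin.mk_one, sum_eps_one, invMetric_comm φ x 1 0]
    match_scalars
    · ring
    · field_simp
      linear_combination hdet
    · ring
    · ring

/-! ### The Gauss map -/

/-- Jacobi's formula with the derivatives of the metric written through the Christoffel symbols. -/
theorem pd_sqrtG_eq_christoffel (h : IsImmersedOn φ U) (hx : x ∈ U) (l : Fin 2) :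
    pd l (sqrtG φ) x = sqrtG φ x * (christoffel φ 0 l 0 x + christoffel φ 1 l 1 x) := by
  have hs := (h.sqrtG_pos hx).ne'
  have c := h.pd_sqrtG hx l
  have hss := h.sqrtG_mul_self hx
  rw [h.pd_metric hx, h.pd_metric hx, h.pd_metric hx] at c
  simp only [real_inner_comm (pd l (pd _ φ) x) (pd _ φ x),
    ← h.sum_christoffel_mul_metric hx] at c
  rw [metric_comm φ x 1 0] at c
  refine mul_left_cancel₀ hs ?_
  linear_combination c / 2 - (christoffel φ 0 l 0 x + christoffel φ 1 l 1 x) * hss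

theorem starN_eq (φ : Plane → Amb m) (x : Plane) :
    starN φ x = (sqrtG φ x)⁻¹ • wedge (pd 0 φ x) (pd 1 φ x) := by
  rw [starN, sum_sum_eps fun a b => wedge (pd a φ x) (pd b φ x),
    wedge_swap (pd 0 φ x) (pd 1 φ x)]
  module

theorem contDiffOn_starN (h : IsImmersedOn φ U) : ContDiffOn ℝ ∞ (starN φ) U :=
  (h.contDiffOn_sqrtG_inv.smul (ContDiffOn.wedge (h.contDiffOn_pd 0) (h.contDiffOn_pd 1))).congr
    fun y _ => starN_eq φ y

/-- Differentiating `|g|^{1/2} ⋆n = ∂₀φ ∧ ∂₁φ`, the Christoffel parts of the second derivatives add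
up to the trace `Γᵏⱼₖ` times `∂₀φ ∧ ∂₁φ`, which the derivative of `|g|^{1/2}` cancels. -/
theorem pd_starN (h : IsImmersedOn φ U) (hx : x ∈ U) (j : Fin 2) :
    pd j (starN φ) x = (sqrtG φ x)⁻¹ • (wedge (sff φ 0 j x) (pd 1 φ x)
      + wedge (pd 0 φ x) (sff φ 1 j x)) := by
  have hs := (h.sqrtG_pos hx).ne'
  have hd (k : Fin 2) := h.differentiableAt (h.contDiffOn_pd k) hx
  have e1 : pd j (fun y => sqrtG φ y • starN φ y) x
      = pd j (fun y => wedge (pd 0 φ y) (pd 1 φ y)) x :=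
    pd_congr j h.isOpen (fun y hy => by
      rw [starN_eq, smul_inv_smul₀ (h.sqrtG_pos hy).ne']) hx
  rw [pd_smul j (h.differentiableAt h.contDiffOn_sqrtG hx)
    (h.differentiableAt h.contDiffOn_starN hx), pd_wedge j (hd 0) (hd 1),
    h.pd_sqrtG_eq_christoffel hx, starN_eq, pd_pd_eq φ x j 0, pd_pd_eq φ x j 1,
    h.sff_comm hx j 0, h.sff_comm hx j 1] at e1
  simp only [wedge_add_left, wedge_add_right, wedge_smul_left, wedge_smul_right, wedge_self,
    smul_zero, add_zero] at e1
  rw [smul_smul, mul_right_comm, mul_inv_cancel₀ hs, one_mul] at e1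
  refine h.eq_of_sqrtG_smul_eq hx ?_
  rw [smul_inv_smul₀ hs]
  linear_combination (norm := module) e1

theorem two_smul_meanCurv (h : IsImmersedOn φ U) (hx : x ∈ U) :
    (2 : ℝ) • meanCurv φ x = invMetric φ x 0 0 • sff φ 0 0 x
      + (2 * invMetric φ x 0 1) • sff φ 0 1 x + invMetric φ x 1 1 • sff φ 1 1 x := by
  simp only [meanCurv, Fin.sum_univ_two, h.sff_comm hx 1 0, invMetric_comm φ x 1 0]
  module

end IsImmersedOn

/-! ### Existence of the potentials `L`, `S`, `R` -/

namespace IsImmersedOn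

variable {m : ℕ} {φ : Plane → Amb m} {U : Set Plane} {x : Plane}

/-- As `Tʲ - Fʲ = -∇ʲH`, only `H` remains in the condition on `L`. -/
theorem isPotentialL_iff (h : IsImmersedOn φ U) {L : Plane → Amb m} :
    IsPotentialL φ (chenField φ) L U ↔ ContDiffOn ℝ ∞ L U ∧ ∀ x ∈ U, ∀ j,
      -grad φ (meanCurv φ) j x = (sqrtG φ x)⁻¹ • ∑ k, eps k j • pd k L x := by
  refine and_congr_right fun _ => forall₂_congr fun x hx => forall_congr' fun j => ?_
  rw [h.stress_eq hx, sub_eq_add_neg]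
  exact add_right_inj _

theorem pd_of_isPotentialL (h : IsImmersedOn φ U) {L : Plane → Amb m}
    (hL : IsPotentialL φ (chenField φ) L U) (hx : x ∈ U) :
    pd 0 L x = -(sqrtG φ x • grad φ (meanCurv φ) 1 x) ∧
      pd 1 L x = sqrtG φ x • grad φ (meanCurv φ) 0 x := by
  have := (h.eq_rot_iff hx (fun j => -grad φ (meanCurv φ) j x) fun k => pd k L x).1
    ((h.isPotentialL_iff.1 hL).2 x hx)
  rwa [smul_neg, smul_neg, neg_neg] at this

theorem exists_isPotentialL (h : IsImmersedOn φ U) (hC : ∀ x ∈ U, lap φ (meanCurv φ) x = 0)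
    (hsc : IsSimplyConnected U) : ∃ L, IsPotentialL φ (chenField φ) L U := by
  have hgH := h.contDiffOn_grad h.contDiffOn_meanCurv
  obtain ⟨L, hL⟩ := h.exists_potential hsc (T := fun j y => -grad φ (meanCurv φ) j y)
    (fun j => (hgH j).neg) fun x hx => by
      have h1 := h.divg_const_smul hx (-1) hgH
      have h2 : divg φ (grad φ (meanCurv φ)) x = 0 := hC x hx
      simpa only [neg_one_smul, h2, neg_zero] using h1
  exact ⟨L, h.isPotentialL_iff.2 hL⟩

theorem contDiffOn_inner_meanCurv (h : IsImmersedOn φ U) :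
    ContDiffOn ℝ ∞ (fun y => (inner ℝ (φ y) (meanCurv φ y) : ℝ)) U :=
  h.contDiffOn.inner ℝ h.contDiffOn_meanCurv

theorem contDiffOn_rot {V : Type*} [NormedAddCommGroup V] [NormedSpace ℝ V]
    (h : IsImmersedOn φ U) {B : Fin 2 → Plane → V}
    (hB : ∀ k, ContDiffOn ℝ ∞ (B k) U) (j : Fin 2) :
    ContDiffOn ℝ ∞ (fun y => (sqrtG φ y)⁻¹ • ∑ k, eps k j • B k y) U :=
  h.contDiffOn_sqrtG_inv.smul <| ContDiffOn.sum fun k _ => (hB k).const_smul (eps k j)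

/-- The rotated field `L · ∂ₖφ` has divergence `∇ʲH · ∂ⱼφ = -2|H|²`, which is `ΔY`; subtracting
`∇ʲY` leaves a divergence-free field. -/
theorem exists_potentialS (h : IsImmersedOn φ U) (hC : ∀ x ∈ U, lap φ (meanCurv φ) x = 0)
    (hsc : IsSimplyConnected U) {L : Plane → Amb m} (hL : IsPotentialL φ (chenField φ) L U) :
    ∃ S : Plane → ℝ, ContDiffOn ℝ ∞ S U ∧ ∀ x ∈ U, ∀ j,
      (sqrtG φ x)⁻¹ * ∑ k, eps k j * inner ℝ (L x) (pd k φ x)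
        = grad φ (fun y => (inner ℝ (φ y) (meanCurv φ y) : ℝ)) j x
          + (sqrtG φ x)⁻¹ * ∑ k, eps k j * pd k S x := by
  let Y : Plane → ℝ := fun y => inner ℝ (φ y) (meanCurv φ y)
  let B : Fin 2 → Plane → ℝ := fun k y => inner ℝ (L y) (pd k φ y)
  have hB (k : Fin 2) : ContDiffOn ℝ ∞ (B k) U := hL.1.inner ℝ (h.contDiffOn_pd k)
  have hY := h.contDiffOn_grad h.contDiffOn_inner_meanCurv
  obtain ⟨S, hS, hS'⟩ := h.exists_potential hsc
    (T := fun j y => (sqrtG φ y)⁻¹ • (∑ k, eps k j • B k y) + (-1 : ℝ) • grad φ Y j y)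
    (fun j => (h.contDiffOn_rot hB j).add ((hY j).const_smul (-1 : ℝ))) fun x hx => by
      have hLx := h.differentiableAt hL.1 hx
      have hp (k : Fin 2) := h.differentiableAt (h.contDiffOn_pd k) hx
      obtain ⟨hL0, hL1⟩ := h.pd_of_isPotentialL hL hx
      have hlap : divg φ (grad φ Y) x = -2 * ‖meanCurv φ x‖ ^ 2 := h.lap_inner_meanCurv hx (hC x hx)
      have hs := (h.sqrtG_pos hx).ne'
      rw [h.divg_add hx (h.contDiffOn_rot hB) fun j => (hY j).const_smul (-1 : ℝ),
        h.divg_const_smul hx (-1) hY, h.divg_rot hx, hlap,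
        pd_inner 1 hLx (hp 0), pd_inner 0 hLx (hp 1), hL0, hL1, h.pd_pd_comm hx 1 0,
        inner_neg_left, real_inner_smul_left, real_inner_smul_left,
        h.inner_grad_meanCurv_pd hx, h.inner_grad_meanCurv_pd hx, h.sff_comm hx 1 0,
        invMetric_comm φ x 1 0]
      simp only [smul_eq_mul]
      field_simp
      linear_combination -sqrtG φ x * h.sum_invMetric_mul_inner_sff hx
  refine ⟨S, hS, fun x hx j => ?_⟩
  have := hS' x hx j
  simp only [smul_eq_mul] at this
  linear_combination this

/-- The rotated field `L ∧ ∂ₖφ` has divergence `∇ʲH ∧ ∂ⱼφ`, and so has `H ∧ ∇ʲφ`, because `H ∧ Δφ =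
2 H ∧ H = 0`. -/
theorem exists_potentialR (h : IsImmersedOn φ U)
    (hsc : IsSimplyConnected U) {L : Plane → Amb m} (hL : IsPotentialL φ (chenField φ) L U) :
    ∃ R : Plane → TwoVec m, ContDiffOn ℝ ∞ R U ∧ ∀ x ∈ U, ∀ j,
      (sqrtG φ x)⁻¹ • ∑ k, eps k j • wedge (L x) (pd k φ x)
          - wedge (meanCurv φ x) (grad φ φ j x)
        = (sqrtG φ x)⁻¹ • ∑ k, eps k j • pd k R x := by
  let B : Fin 2 → Plane → TwoVec m := fun k y => wedge (L y) (pd k φ y)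
  have hB (k : Fin 2) : ContDiffOn ℝ ∞ (B k) U := ContDiffOn.wedge hL.1 (h.contDiffOn_pd k)
  have hH := h.contDiffOn_meanCurv
  have hg := h.contDiffOn_grad h.contDiffOn
  have hW (j : Fin 2) : ContDiffOn ℝ ∞ (fun y => wedge (meanCurv φ y) (grad φ φ j y)) U :=
    ContDiffOn.wedge hH (hg j)
  obtain ⟨R, hR, hR'⟩ := h.exists_potential hsc
    (T := fun j y => (sqrtG φ y)⁻¹ • (∑ k, eps k j • B k y)
      + (-1 : ℝ) • wedge (meanCurv φ y) (grad φ φ j y))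
    (fun j => (h.contDiffOn_rot hB j).add ((hW j).const_smul (-1 : ℝ))) fun x hx => by
      have hLx := h.differentiableAt hL.1 hx
      have hp (k : Fin 2) := h.differentiableAt (h.contDiffOn_pd k) hx
      obtain ⟨hL0, hL1⟩ := h.pd_of_isPotentialL hL hx
      have hlap : divg φ (grad φ φ) x = (2 : ℝ) • meanCurv φ x := h.lap_self hx
      have hs := (h.sqrtG_pos hx).ne'
      rw [h.divg_add hx (h.contDiffOn_rot hB) fun j => (hW j).const_smul (-1 : ℝ),
        h.divg_const_smul hx (-1) hW, h.divg_wedge hx hg hH, h.divg_rot hx, hlap,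
        pd_wedge 1 hLx (hp 0), pd_wedge 0 hLx (hp 1), hL0, hL1, h.pd_pd_comm hx 1 0,
        wedge_smul_right 2, wedge_self, ← neg_smul, wedge_smul_left, wedge_smul_left]
      simp only [grad, Fin.sum_univ_two, wedge_add_left, wedge_add_right, wedge_smul_left,
        wedge_smul_right, invMetric_comm φ x 1 0]
      match_scalars <;> field_simp <;> ring
  refine ⟨R, hR, fun x hx j => ?_⟩
  refine Eq.trans ?_ (hR' x hx j)
  module

theorem exists_isPotentialSR (h : IsImmersedOn φ U) (hC : ∀ x ∈ U, lap φ (meanCurv φ) x = 0)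
    (hsc : IsSimplyConnected U) {L : Plane → Amb m} (hL : IsPotentialL φ (chenField φ) L U) :
    ∃ S R, IsPotentialSR φ (fun _ => 0) (fun y => (inner ℝ (φ y) (meanCurv φ y) : ℝ)) L S R U := by
  obtain ⟨S, hS, hS'⟩ := h.exists_potentialS hC hsc hL
  obtain ⟨R, hR, hR'⟩ := h.exists_potentialR hsc hL
  refine ⟨S, R, hS, hR, fun x hx j => ⟨hS' x hx j, ?_⟩⟩
  rw [hR' x hx j]
  simp [grad, pd_const]

/-! ### The system for `S`, `R` and `φ` -/

section System

variable {L : Plane → Amb m} {S : Plane → ℝ} {R : Plane → TwoVec m}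

theorem pd_potentialS (h : IsImmersedOn φ U) {X : Plane → TwoVec m} {Y : Plane → ℝ}
    (hSR : IsPotentialSR φ X Y L S R U) (hx : x ∈ U) :
    pd 0 S x = inner ℝ (L x) (pd 0 φ x) - sqrtG φ x * grad φ Y 1 x ∧
      pd 1 S x = inner ℝ (L x) (pd 1 φ x) + sqrtG φ x * grad φ Y 0 x := by
  have hs := (h.sqrtG_pos hx).ne'
  obtain ⟨h0, h1⟩ := (h.eq_rot_iff hx
    (fun j => -grad φ Y j x)
    (fun k => pd k S x - inner ℝ (L x) (pd k φ x))).1 fun j => by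
      have := (hSR.2.2 x hx j).1
      simp only [smul_eq_mul, Fin.sum_univ_two] at this ⊢
      linear_combination this
  simp only [smul_eq_mul] at h0 h1
  exact ⟨by linear_combination h0, by linear_combination h1⟩

theorem pd_potentialR (h : IsImmersedOn φ U) {Y : Plane → ℝ}
    (hSR : IsPotentialSR φ (fun _ => 0) Y L S R U) (hx : x ∈ U) :
    pd 0 R x = wedge (L x) (pd 0 φ x)
        - sqrtG φ x • wedge (meanCurv φ x) (grad φ φ 1 x) ∧
      pd 1 R x = wedge (L x) (pd 1 φ x)
        + sqrtG φ x • wedge (meanCurv φ x) (grad φ φ 0 x) := by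
  obtain ⟨h0, h1⟩ := (h.eq_rot_iff hx
    (fun j => -wedge (meanCurv φ x) (grad φ φ j x))
    (fun k => pd k R x - wedge (L x) (pd k φ x))).1 fun j => by
      have := (hSR.2.2 x hx j).2
      have h0 : grad φ (fun _ : Plane => (0 : TwoVec m)) j x = 0 := by simp [grad, pd_const]
      rw [h0, zero_add] at this
      simp only [Fin.sum_univ_two] at this ⊢
      linear_combination (norm := module) this
  exact ⟨by linear_combination (norm := module) h0, by linear_combination (norm := module) h1⟩

/-- Isolates a rotated gradient of `Y`, which is divergence-free and drops out of `ΔS`. -/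
theorem grad_potentialS (h : IsImmersedOn φ U) {X : Plane → TwoVec m} {Y : Plane → ℝ}
    (hSR : IsPotentialSR φ X Y L S R U) (hx : x ∈ U) (j : Fin 2) :
    grad φ S j x = inner ℝ (grad φ φ j x) (L x) + (sqrtG φ x)⁻¹ • ∑ k, eps k j • pd k Y x := by
  obtain ⟨h0, h1⟩ := h.pd_potentialS hSR hx
  rw [h.grad_of_pd_eq hx (p := fun k => inner ℝ (L x) (pd k φ x)) (q := fun k => pd k Y x)
    (by simpa [grad] using h0) (by simpa [grad] using h1)]
  simp only [grad, Fin.sum_univ_two, inner_add_right, inner_smul_right, real_inner_comm (L x),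
    smul_eq_mul]

theorem grad_potentialR (h : IsImmersedOn φ U) {Y : Plane → ℝ}
    (hSR : IsPotentialSR φ (fun _ => 0) Y L S R U) (hx : x ∈ U) (j : Fin 2) :
    grad φ R j x = wedge (L x) (grad φ φ j x)
      + (sqrtG φ x)⁻¹ • ∑ k, eps k j • wedge (meanCurv φ x) (pd k φ x) := by
  obtain ⟨h0, h1⟩ := h.pd_potentialR hSR hx
  rw [h.grad_of_pd_eq hx (p := fun k => wedge (L x) (pd k φ x))
    (q := fun k => wedge (meanCurv φ x) (pd k φ x))
    (by simpa only [grad, Fin.sum_univ_two, wedge_add_right, wedge_smul_right] using h0)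
    (by simpa only [grad, Fin.sum_univ_two, wedge_add_right, wedge_smul_right] using h1)]
  simp only [grad, Fin.sum_univ_two, wedge_add_right, wedge_smul_right]

theorem grad_self_eq (φ : Plane → Amb m) (x : Plane) (j : Fin 2) :
    grad φ φ j x = invMetric φ x j 0 • pd 0 φ x + invMetric φ x j 1 • pd 1 φ x := by
  rw [grad, Fin.sum_univ_two]

/-- `ΔS` is `L · Δφ + ∂ⱼL · ∇ʲφ`. The last term is proportional to `∂₀H · ∂₁φ - ∂₁H · ∂₀φ`, which
vanishes because `hⱼₖ` is symmetric. -/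
theorem lap_potentialS (h : IsImmersedOn φ U) {X : Plane → TwoVec m} {Y : Plane → ℝ}
    (hY : ContDiffOn ℝ ∞ Y U) (hL : IsPotentialL φ (chenField φ) L U)
    (hSR : IsPotentialSR φ X Y L S R U) (hx : x ∈ U) :
    lap φ S x = 2 * inner ℝ (L x) (meanCurv φ x) := by
  have hg := h.contDiffOn_grad h.contDiffOn
  have hlap : divg φ (grad φ φ) x = (2 : ℝ) • meanCurv φ x := h.lap_self hx
  obtain ⟨hL0, hL1⟩ := h.pd_of_isPotentialL hL hx
  rw [lap, h.divg_congr hx (fun j y hy => h.grad_potentialS hSR hy j),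
    h.divg_add hx (fun j => (hg j).inner ℝ hL.1)
      (h.contDiffOn_rot fun k => ContDiffOn.pd k h.isOpen hY),
    h.divg_inner hx hg hL.1, h.divg_rot hx, pd_comm 1 0 h.isOpen hY hx, hlap, hL0, hL1,
    real_inner_smul_left, real_inner_comm (L x), inner_neg_right, inner_smul_right,
    inner_smul_right, real_inner_comm (grad φ (meanCurv φ) 1 x),
    real_inner_comm (grad φ (meanCurv φ) 0 x)]
  simp only [grad_self_eq φ x, inner_add_right, inner_smul_right,
    h.inner_grad_meanCurv_pd hx, h.sff_comm hx 1 0, invMetric_comm φ x 1 0, smul_eq_mul]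
  ring

/-- Here `∂ⱼL ∧ ∇ʲφ` need not vanish: it equals `|g|^{-1/2} (∂₀H ∧ ∂₁φ - ∂₁H ∧ ∂₀φ)` and cancels the
divergence of the rotated field `H ∧ ∂ₖφ`, leaving `L ∧ Δφ`. -/
theorem lap_potentialR (h : IsImmersedOn φ U) {Y : Plane → ℝ}
    (hL : IsPotentialL φ (chenField φ) L U)
    (hSR : IsPotentialSR φ (fun _ => 0) Y L S R U) (hx : x ∈ U) :
    lap φ R x = wedge (L x) ((2 : ℝ) • meanCurv φ x) := by
  have hg := h.contDiffOn_grad h.contDiffOn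
  have hH := h.contDiffOn_meanCurv
  have hHx := h.differentiableAt hH hx
  have hp (k : Fin 2) := h.differentiableAt (h.contDiffOn_pd k) hx
  have hlap : divg φ (grad φ φ) x = (2 : ℝ) • meanCurv φ x := h.lap_self hx
  have hs := (h.sqrtG_pos hx).ne'
  have hdet := h.sq_sqrtG_mul_det_invMetric hx
  obtain ⟨hL0, hL1⟩ := h.pd_of_isPotentialL hL hx
  rw [lap, h.divg_congr hx (fun j y hy => h.grad_potentialR hSR hy j),
    h.divg_add hx (fun j => ContDiffOn.wedge hL.1 (hg j))
      (h.contDiffOn_rot fun k => ContDiffOn.wedge hH (h.contDiffOn_pd k)),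
    h.divg_wedge hx hg hL.1, h.divg_rot hx, pd_wedge 1 hHx (hp 0), pd_wedge 0 hHx (hp 1),
    h.pd_pd_comm hx 1 0, hlap, hL0, hL1, ← neg_smul, wedge_smul_left, wedge_smul_left]
  simp only [grad, Fin.sum_univ_two, wedge_add_left, wedge_add_right, wedge_smul_left,
    wedge_smul_right, invMetric_comm φ x 1 0]
  match_scalars <;> field_simp
  · ring
  · linear_combination -hdet
  · linear_combination hdet
  · ring
  · ring

/-- The conservative system satisfied by `S`, `R` and `φ`. -/
theorem potential_system (h : IsImmersedOn φ U) (hC : ∀ x ∈ U, lap φ (meanCurv φ) x = 0)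
    {Y : Plane → ℝ} (hY : Y = fun y => (inner ℝ (φ y) (meanCurv φ y) : ℝ))
    (hL : IsPotentialL φ (chenField φ) L U)
    (hSR : IsPotentialSR φ (fun _ => 0) Y L S R U) (hx : x ∈ U) :
    sqrtG φ x * lap φ S x
        = ∑ j, ∑ k, eps j k * inner ℝ (pd j (starN φ) x) (pd k R x) ∧
      sqrtG φ x • lap φ R x
        = -∑ j, ∑ k, eps j k • (pd k S x • pd j (starN φ) x
            + contract (pd j (starN φ) x) (pd k R x))
          + sqrtG φ x • divg φ (fun j y => grad φ Y j y • starN φ y) x ∧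
      sqrtG φ x • lap φ φ x
        = ∑ j, ∑ k, eps j k • (pd j S x • pd k φ x + interiorMul (pd j R x) (pd k φ x))
          + sqrtG φ x • ∑ j, grad φ Y j x • pd j φ x := by
  have hs := (h.sqrtG_pos hx).ne'
  have hYs : ContDiffOn ℝ ∞ Y U := hY ▸ h.contDiffOn_inner_meanCurv
  have hlapY : divg φ (grad φ Y) x
      = -(invMetric φ x 0 0 * inner ℝ (meanCurv φ x) (sff φ 0 0 x)
      + 2 * invMetric φ x 0 1 * inner ℝ (meanCurv φ x) (sff φ 0 1 x)
      + invMetric φ x 1 1 * inner ℝ (meanCurv φ x) (sff φ 1 1 x)) := by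
    rw [h.sum_invMetric_mul_inner_sff hx, hY]
    exact (h.lap_inner_meanCurv hx (hC x hx)).trans (neg_mul _ _)
  obtain ⟨g00, g01, g11⟩ := h.metric_eq hx
  have hN0 := h.pd_starN hx 0
  have hN1 := h.pd_starN hx 1
  rw [h.sff_comm hx 1 0] at hN0
  obtain ⟨hS0, hS1⟩ := h.pd_potentialS hSR hx
  obtain ⟨hR0, hR1⟩ := h.pd_potentialR hSR hx
  rw [grad_self_eq, invMetric_comm φ x 1 0] at hR0
  rw [grad_self_eq] at hR1
  -- The left sides are now `2 L · H`, `2 L ∧ H` and `2H`, up to `|g|^{1/2}`, and all first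
  -- derivatives on the right are explicit; each equation is one of the pointwise identities.
  refine ⟨?_, ?_, ?_⟩
  · have key := inner_gaussMap_potential (L := L x) hs (h.inner_sff_pd hx 0 0 0)
      (h.inner_sff_pd hx 0 0 1) (h.inner_sff_pd hx 0 1 0) (h.inner_sff_pd hx 0 1 1)
      (h.inner_sff_pd hx 1 1 0) (h.inner_sff_pd hx 1 1 1) (h.inner_meanCurv_pd hx 0)
      (h.inner_meanCurv_pd hx 1) g00 g01 g11 (h.two_smul_meanCurv hx)
    rw [← hN0, ← hN1, ← hR0, ← hR1] at key
    have h1 := sum_sum_eps fun j k => (inner ℝ (pd j (starN φ) x) (pd k R x) : ℝ)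
    simp only [smul_eq_mul] at h1
    rw [h.lap_potentialS hYs hL hSR hx, h1, key]
    ring
  · have key := contract_gaussMap_potential (L := L x) hs (h.inner_sff_pd hx 0 0 0)
      (h.inner_sff_pd hx 0 0 1) (h.inner_sff_pd hx 0 1 0) (h.inner_sff_pd hx 0 1 1)
      (h.inner_sff_pd hx 1 1 0) (h.inner_sff_pd hx 1 1 1) (h.inner_meanCurv_pd hx 0)
      (h.inner_meanCurv_pd hx 1) g00 g01 g11 (h.two_smul_meanCurv hx) hlapY
      (Y0 := grad φ Y 0 x) (Y1 := grad φ Y 1 x)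
    rw [← hN0, ← hN1, ← hR0, ← hR1, ← hS0, ← hS1, ← starN_eq] at key
    rw [h.lap_potentialR hL hSR hx, key, h.divg_smul_right hx (h.contDiffOn_grad hYs)
      h.contDiffOn_starN, sum_sum_eps fun j k => pd k S x • pd j (starN φ) x
        + contract (pd j (starN φ) x) (pd k R x)]
  · have key := interiorMul_potential (L := L x) (h.inner_meanCurv_pd hx 0)
      (h.inner_meanCurv_pd hx 1) g00 g01 g11 (h.sq_sqrtG_mul_det_invMetric hx)
      (Y0 := grad φ Y 0 x) (Y1 := grad φ Y 1 x)
    rw [← hR0, ← hR1, ← hS0, ← hS1] at key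
    rw [h.lap_self hx, smul_smul, mul_comm, key,
      Fin.sum_univ_two (fun j => grad φ Y j x • pd j φ x),
      sum_sum_eps fun j k => pd j S x • pd k φ x + interiorMul (pd j R x) (pd k φ x)]
    module

end System

end IsImmersedOn
end Surface
end

/-! ### The main theorem -/

open Surface in
theorem mainTheorem4 {m : ℕ} {M : Type*} [TopologicalSpace M] [ChartedSpace Plane M]
    [IsManifold 𝓘(ℝ, Plane) ∞ M] (Φ : M → Amb m) (hΦ : IsSmoothImmersion Φ)
    (hChen : SatisfiesChen Φ)
    (e : OpenPartialHomeomorph M Plane) (he : e ∈ IsManifold.maximalAtlas 𝓘(ℝ, Plane) ∞ M)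
    (φ : Plane → Amb m) (hφ : φ = Φ ∘ e.symm)
    (X : Plane → TwoVec m) (hX : X = fun _ => 0)
    (Y : Plane → ℝ) (hY : Y = fun x => inner ℝ (φ x) (meanCurv φ x)) :
    -- the Willmore operator
    (∀ x ∈ e.target, willmore φ x
      = (2 : ℝ) • ∑ j, ∑ k, inner ℝ (meanCurv φ x) (sffUp φ j k x) • sff φ j k x
        - (2 * ‖meanCurv φ x‖ ^ 2) • meanCurv φ x) ∧
    -- the choices `X = 0` and `Y = Φ · H` are admissible
    SideSystem φ (chenField φ) X Y e.target ∧
    (∀ x ∈ e.target, lap φ Y x = -2 * ‖meanCurv φ x‖ ^ 2) ∧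
    -- the potentials exist on simply connected domains, and satisfy the system with `Φ`
    ∀ U : Set Plane, IsOpen U → U ⊆ e.target →
      (IsSimplyConnected U → ∃ L, IsPotentialL φ (chenField φ) L U) ∧
      (IsSimplyConnected U → ∀ L, IsPotentialL φ (chenField φ) L U →
        ∃ S R, IsPotentialSR φ X Y L S R U) ∧
      (∀ L S R, IsPotentialL φ (chenField φ) L U → IsPotentialSR φ X Y L S R U →
        ∀ x ∈ U,
          sqrtG φ x * lap φ S x
            = ∑ j, ∑ k, eps j k * inner ℝ (pd j (starN φ) x) (pd k R x) ∧
          sqrtG φ x • lap φ R x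
            = -∑ j, ∑ k, eps j k • (pd k S x • pd j (starN φ) x
                + contract (pd j (starN φ) x) (pd k R x))
              + sqrtG φ x • divg φ (fun j y => grad φ Y j y • starN φ y) x ∧
          sqrtG φ x • lap φ φ x
            = ∑ j, ∑ k, eps j k • (pd j S x • pd k φ x + interiorMul (pd j R x) (pd k φ x))
              + sqrtG φ x • ∑ j, grad φ Y j x • pd j φ x) := by
  have h : IsImmersedOn φ e.target := by
    rw [hφ]
    exact ⟨e.open_target, contDiffOn_comp_chart_symm hΦ he, fun x hx =>
      det_metric_pos_of_injective (fderiv_comp_chart_symm_injective hΦ he hx)⟩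
  have hC : ∀ x ∈ e.target, lap φ (meanCurv φ) x = 0 := by
    rw [hφ]
    exact hChen e he
  subst hX
  refine ⟨fun x hx => h.willmore_eq hx (hC x hx), hY ▸ h.sideSystem hC,
    fun x hx => hY ▸ h.lap_inner_meanCurv hx (hC x hx), fun U hU hsub => ?_⟩
  -- Everything restricts to `U`. The system is a pointwise consequence of the decompositions, so
  -- simple connectedness enters only in the existence of the potentials.
  have hU' := h.mono hU hsub
  have hCU : ∀ x ∈ U, lap φ (meanCurv φ) x = 0 := fun x hx => hC x (hsub hx)
  exact ⟨hU'.exists_isPotentialL hCU,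
    fun hsc L hL => hY ▸ hU'.exists_isPotentialSR hCU hsc hL,
    fun L S R hL hSR x hx => hU'.potential_system hCU hY hL hSR hx⟩
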